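/- Let $F$ be a field of characteristic $2$. **Colength functions.** Let $I=[0,1]\cap\mathbb Z[\tfrac12]$ and let $X$ be the $\mathbb Q$-vector space of functions $I\to\mathbb Q$. For a nonzero element $f$ of the maximal ideal of $F[[u_1,\dots,u_r]]$, let $\phi_f\in X$ be the (well-defined) function $$\phi_f\!\left(\tfrac iq\right)=q^{-r}\dim_F F[[u_1,\dots,u_r]]/(u_1^q,\dots,u_r^q,f^i)\qquad(q \text{ a power of } 2,\ 0\le i\le q).$$ **The product $\#$.** For $\alpha\in X$ put $\alpha_0(t)=\alpha(\tfrac t2)$ and $\alpha_1(t)=\alpha(\tfrac{1+t}2)$. For $\alpha,\beta\in X$ the element $\alpha\#\beta$ of $X$ is defined by induction on the denominator of $t\in I$ by: 1. $(\alpha\#\beta)(0)=0$ and $(\alpha\#\beta)(1)=(\alpha(1)-\alpha(0))(\beta(1)-\beta(0))$; 2. $(\alpha\#\beta)(t)=(\alpha_0\#\beta_0)(2t)+(\alpha_1\#\beta_1)(2t)$ for $0\le t\le\tfrac12$; 3. $(\alpha\#\beta)(t)=(\alpha_0\#\beta_0)(1)+(\alpha_1\#\beta_1)(1)+(\alpha_0\#\beta_1)(2t-1)+(\alpha_1\#\beta_0)(2t-1)$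 for $\tfrac12\le t\le1$. **The ring $\Gamma$.** Let $\Gamma$ be the Grothendieck group (with respect to direct sums) of isomorphism classes of finitely generated $F[T]$-modules annihilated by a power of $T$, with the multiplication $[V][W]=[V\otimes_F W]$, where $T$ acts on $V\otimes_F W$ by $T_V\otimes\mathrm{id}+\mathrm{id}\otimes T_W$; let $\Gamma_{\mathbb Q}=\Gamma\otimes_{\mathbb Z}\mathbb Q$. For $i\ge0$ let $\lambda_i=(-1)^i\bigl([F[T]/T^{i+1}]-[F[T]/T^i]\bigr)\in\Gamma$. For $\alpha\in X$, $n\ge0$ and $q=2^n$ let $$\mathcal L_n(\alpha)=\sum_{i=0}^{q-1}\Bigl(\alpha\bigl(\tfrac{i+1}q\bigr)-\alpha\bigl(\tfrac iq\bigr)\Bigr)(-1)^i\lambda_i\in\Gamma_{\mathbb Q}.$$ **Theorem 1.9.** Let $f\ne0$ and $g\ne0$ be in the maximal ideals of $F[[u_1,\dots,u_r]]$ and $F[[v_1,\dots,v_s]]$, and let $h=f(u_1,\dots,u_r)+g(v_1,\dots,v_s)\in F[[u_1,\dots,u_r,v_1,\dots,v_s]]$. Then: 1. for every $n\ge0$,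 $\mathcal L_n(\phi_h)=\mathcal L_n(\phi_f)\cdot\mathcal L_n(\phi_g)$ in $\Gamma_{\mathbb Q}$; 2. $\phi_h=\phi_f\#\phi_g$. -/

import Mathlib

open scoped TensorProduct

noncomputable section

/-! ### Functions on the dyadic rationals of the unit interval -/

/-- `I = [0,1] ∩ ℤ[1/2]`. -/
def DyadicI : Type := {t : ℚ // 0 ≤ t ∧ t ≤ 1 ∧ ∃ (n : ℕ) (k : ℤ), t = k / 2 ^ n}

namespace DyadicI

/-- The point `i / 2 ^ n` of `I`. -/
def node (n i : ℕ) (hi : i ≤ 2 ^ n) : DyadicI :=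
  ⟨(i : ℚ) / 2 ^ n, by positivity,
    (div_le_one (by positivity)).2 (by exact_mod_cast hi), n, i, by simp⟩

/-- The point `0` of `I`. -/
def zero : DyadicI := ⟨0, le_rfl, zero_le_one, 0, 0, by simp⟩

/-- The point `1` of `I`. -/
def one : DyadicI := ⟨1, zero_le_one, le_rfl, 0, 1, by simp⟩

/-- `t ↦ t / 2`. -/
def half (t : DyadicI) : DyadicI :=
  ⟨t.1 / 2, by linarith [t.2.1], by linarith [t.2.2.1], by
    obtain ⟨n, k, h⟩ := t.2.2.2
    exact ⟨n + 1, k, by rw [h]; field_simp; ring⟩⟩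

/-- `t ↦ (1 + t) / 2`. -/
def halfSucc (t : DyadicI) : DyadicI :=
  ⟨(1 + t.1) / 2, by linarith [t.2.1], by linarith [t.2.2.1], by
    obtain ⟨n, k, h⟩ := t.2.2.2
    exact ⟨n + 1, 2 ^ n + k, by rw [h]; push_cast; field_simp; ring⟩⟩

/-- `t ↦ 2 t`, for `t ≤ 1 / 2`. -/
def double (t : DyadicI) (ht : t.1 ≤ 1 / 2) : DyadicI :=
  ⟨2 * t.1, by linarith [t.2.1], by linarith, by
    obtain ⟨n, k, h⟩ := t.2.2.2
    exact ⟨n, 2 * k, by rw [h]; push_cast; ring⟩⟩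

/-- `t ↦ 2 t - 1`, for `1 / 2 ≤ t`. -/
def doublePred (t : DyadicI) (ht : 1 / 2 ≤ t.1) : DyadicI :=
  ⟨2 * t.1 - 1, by linarith, by linarith [t.2.2.1], by
    obtain ⟨n, k, h⟩ := t.2.2.2
    exact ⟨n, 2 * k - 2 ^ n, by rw [h]; push_cast; field_simp⟩⟩

theorem den_eq_two_pow (t : DyadicI) (h0 : t.1 ≠ 0) (h1 : t.1 ≠ 1) :
    ∃ m : ℕ, t.1.den = 2 ^ (m + 1) := by
  obtain ⟨q, hq0, hq1, n, k, h⟩ := t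
  simp only at h0 h1 ⊢
  have hd : q.den ∣ 2 ^ n := by
    have := Rat.den_dvd k (2 ^ n)
    rw [Rat.divInt_eq_div] at this
    push_cast at this
    rw [← h] at this
    exact_mod_cast this
  obtain ⟨m, -, hm⟩ := (Nat.dvd_prime_pow Nat.prime_two).1 hd
  cases m with
  | succ m => exact ⟨m, hm⟩
  | zero =>
    exfalso
    have hn : (q.num : ℚ) = q := Rat.coe_int_num_of_den_eq_one (by simpa using hm)
    rw [← hn] at hq0 hq1 h0 h1
    have a0 : (0 : ℤ) ≤ q.num := by exact_mod_cast hq0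
    have a1 : q.num ≤ 1 := by exact_mod_cast hq1
    have a2 : q.num ≠ 0 := by exact_mod_cast h0
    have a3 : q.num ≠ 1 := by exact_mod_cast h1
    omega

theorem one_den_lt (t : DyadicI) (h0 : t.1 ≠ 0) (h1 : t.1 ≠ 1) : one.1.den < t.1.den := by
  obtain ⟨m, hm⟩ := t.den_eq_two_pow h0 h1
  rw [hm]
  exact Nat.one_lt_two_pow (Nat.succ_ne_zero m)

theorem den_lt_aux (t : DyadicI) (h0 : t.1 ≠ 0) (h1 : t.1 ≠ 1) (c : ℤ) :
    (2 * t.1 - c).den < t.1.den := by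
  obtain ⟨m, hm⟩ := t.den_eq_two_pow h0 h1
  have e : (2 * t.1 - c : ℚ) = Rat.divInt (t.1.num - c * 2 ^ m) (2 ^ m) := by
    rw [Rat.divInt_eq_div]
    push_cast
    have := Rat.num_div_den t.1
    rw [hm] at this
    push_cast at this
    conv_lhs => rw [← this]
    field_simp
    ring
  have hd : (2 * t.1 - c).den ∣ 2 ^ m := by
    rw [e]
    exact_mod_cast Rat.den_dvd (t.1.num - c * 2 ^ m) (2 ^ m)
  calc (2 * t.1 - c).den ≤ 2 ^ m := Nat.le_of_dvd (by positivity) hd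
    _ < t.1.den := by rw [hm]; exact Nat.pow_lt_pow_right (by norm_num) (Nat.lt_succ_self m)

theorem double_den_lt (t : DyadicI) (h0 : t.1 ≠ 0) (h1 : t.1 ≠ 1) (ht : t.1 ≤ 1 / 2) :
    (t.double ht).1.den < t.1.den := by
  simpa [double] using t.den_lt_aux h0 h1 0

theorem doublePred_den_lt (t : DyadicI) (h0 : t.1 ≠ 0) (h1 : t.1 ≠ 1) (ht : 1 / 2 ≤ t.1) :
    (t.doublePred ht).1.den < t.1.den := by
  simpa [doublePred] using t.den_lt_aux h0 h1 1

end DyadicI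

/-- The `ℚ`-vector space `X` of all functions `I → ℚ`. -/
abbrev DyadicFun : Type := DyadicI → ℚ

namespace DyadicFun

/-- `α₀ : t ↦ α (t / 2)`. -/
def T0 (α : DyadicFun) : DyadicFun := fun t => α t.half

/-- `α₁ : t ↦ α ((1 + t) / 2)`. -/
def T1 (α : DyadicFun) : DyadicFun := fun t => α t.halfSucc

/-- The product `α # β`, by recursion on the denominator of the argument. -/
def sharp (α β : DyadicFun) (t : DyadicI) : ℚ :=
  if _h0 : t.1 = 0 then 0
  else if _h1 : t.1 = 1 then
    (α DyadicI.one - α DyadicI.zero) * (β DyadicI.one - β DyadicI.zero)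
  else if h : t.1 ≤ 1 / 2 then
    sharp (T0 α) (T0 β) (t.double h) + sharp (T1 α) (T1 β) (t.double h)
  else
    sharp (T0 α) (T0 β) DyadicI.one + sharp (T1 α) (T1 β) DyadicI.one
      + sharp (T0 α) (T1 β) (t.doublePred (le_of_not_ge h))
      + sharp (T1 α) (T0 β) (t.doublePred (le_of_not_ge h))
termination_by t.1.den
decreasing_by
  all_goals
    first
    | exact t.double_den_lt _h0 _h1 h
    | exact t.doublePred_den_lt _h0 _h1 (le_of_not_ge h)
    | exact t.one_den_lt _h0 _h1

end DyadicFun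

/-! ### The colength function of a power series -/

/-- The colength of `(u₁ ^ q, …, u_r ^ q, f ^ i)` in `F[[u₁, …, u_r]]`, as an `F`-dimension. -/
def frobColength {F σ : Type*} [Field F] (f : MvPowerSeries σ F) (q i : ℕ) : ℕ :=
  Module.finrank F (MvPowerSeries σ F ⧸
    Ideal.span (Set.range (fun j : σ => (MvPowerSeries.X j : MvPowerSeries σ F) ^ q) ∪ {f ^ i}))

/-- `φ_f (i / q) = q ^ (-r) * deg (u₁ ^ q, …, u_r ^ q, f ^ i)`, the fraction `i / q` being taken
in lowest terms. -/
def phi {F σ : Type*} [Field F] [Fintype σ] (f : MvPowerSeries σ F) : DyadicFun :=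
  fun t => (frobColength f t.1.den t.1.num.toNat : ℚ) / (t.1.den : ℚ) ^ Fintype.card σ

/-! ### The representation ring `Γ` -/

universe u

/-- A finitely generated `F[T]`-module annihilated by a power of `T`, i.e. a finite dimensional
`F`-vector space with a nilpotent endomorphism `T`. -/
structure NilMod (F : Type u) [Field F] : Type (u + 1) where
  carrier : Type u
  [addCommGroup : AddCommGroup carrier]
  [module : Module F carrier]
  [finite : Module.Finite F carrier]
  T : carrier →ₗ[F] carrier
  nilpotent : IsNilpotent T

namespace NilMod

attribute [instance] addCommGroup module finite

variable {F : Type u} [Field F]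

/-- Isomorphism of `F[T]`-modules. -/
def Iso (V W : NilMod F) : Prop :=
  ∃ e : V.carrier ≃ₗ[F] W.carrier, e.toLinearMap ∘ₗ V.T = W.T ∘ₗ e.toLinearMap

theorem Iso.refl (V : NilMod F) : Iso V V := ⟨LinearEquiv.refl F _, rfl⟩

theorem Iso.symm {V W : NilMod F} (h : Iso V W) : Iso W V := by
  obtain ⟨e, he⟩ := h
  refine ⟨e.symm, LinearMap.ext fun w => e.injective ?_⟩
  have := LinearMap.congr_fun he (e.symm w)
  simp at this ⊢
  exact this.symm

theorem Iso.trans {U V W : NilMod F} (h : Iso U V) (h' : Iso V W) : Iso U W := by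
  obtain ⟨e, he⟩ := h
  obtain ⟨e', he'⟩ := h'
  refine ⟨e.trans e', LinearMap.ext fun w => ?_⟩
  have h1 := LinearMap.congr_fun he w
  have h2 := LinearMap.congr_fun he' (e w)
  simp at h1 h2 ⊢
  rw [h1, h2]

instance setoid (F : Type u) [Field F] : Setoid (NilMod F) where
  r := Iso
  iseqv := ⟨Iso.refl, Iso.symm, Iso.trans⟩

/-- The direct sum `V ⊕ W`. -/
def sum (V W : NilMod F) : NilMod F where
  carrier := V.carrier × W.carrier
  T := V.T.prodMap W.T
  nilpotent := by
    obtain ⟨m, hm⟩ := V.nilpotent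
    obtain ⟨n, hn⟩ := W.nilpotent
    have key : ∀ k : ℕ, V.T.prodMap W.T ^ k = (V.T ^ k).prodMap (W.T ^ k) := fun k => by
      induction k with
      | zero => rfl
      | succ k ih => rw [pow_succ, ih, pow_succ, pow_succ, LinearMap.prodMap_mul]
    refine ⟨m + n, ?_⟩
    rw [key, pow_add, hm, pow_add, hn, zero_mul, mul_zero, LinearMap.prodMap_zero]

/-- The tensor product `V ⊗_F W`, with `T` acting by `T_V ⊗ id + id ⊗ T_W`. -/
def tensor (V W : NilMod F) : NilMod F where
  carrier := V.carrier ⊗[F] W.carrier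
  T := TensorProduct.map V.T LinearMap.id + TensorProduct.map LinearMap.id W.T
  nilpotent := by
    refine Commute.isNilpotent_add ?_ ?_ ?_
    · change _ * _ = _ * _
      rw [← TensorProduct.map_mul, ← TensorProduct.map_mul]
      rfl
    · obtain ⟨m, hm⟩ := V.nilpotent
      exact ⟨m, by rw [TensorProduct.map_pow, hm, TensorProduct.map_zero_left]⟩
    · obtain ⟨m, hm⟩ := W.nilpotent
      exact ⟨m, by rw [TensorProduct.map_pow, hm, TensorProduct.map_zero_right]⟩

/-- The one-dimensional module `F`, with `T = 0`. -/
def unit (F : Type u) [Field F] : NilMod F where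
  carrier := F
  T := 0
  nilpotent := IsNilpotent.zero

/-- The cyclic module `F[T] / (T ^ r)`. -/
def cyclic (F : Type u) [Field F] (r : ℕ) : NilMod F where
  carrier := Polynomial F ⧸ Ideal.span {(Polynomial.X : Polynomial F) ^ r}
  finite := (Polynomial.monic_X_pow r).finite_quotient
  T := LinearMap.mulLeft F
    (Ideal.Quotient.mk (Ideal.span {(Polynomial.X : Polynomial F) ^ r}) Polynomial.X)
  nilpotent := by
    refine ⟨r, ?_⟩
    rw [LinearMap.pow_mulLeft, ← map_pow,
      Ideal.Quotient.eq_zero_iff_mem.2 (Ideal.mem_span_singleton_self _), LinearMap.mulLeft_zero_eq_zero]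

theorem Iso.sum {V V' W W' : NilMod F} (h : Iso V V') (h' : Iso W W') :
    Iso (V.sum W) (V'.sum W') := by
  obtain ⟨e, he⟩ := h
  obtain ⟨e', he'⟩ := h'
  refine ⟨e.prodCongr e', LinearMap.ext fun x => ?_⟩
  exact Prod.ext (LinearMap.congr_fun he x.1) (LinearMap.congr_fun he' x.2)

theorem Iso.tensor {V V' W W' : NilMod F} (h : Iso V V') (h' : Iso W W') :
    Iso (V.tensor W) (V'.tensor W') := by
  obtain ⟨e, he⟩ := h
  obtain ⟨e', he'⟩ := h'
  refine ⟨TensorProduct.congr e e', TensorProduct.ext' fun x y => ?_⟩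
  have h1 : e (V.T x) = V'.T (e x) := LinearMap.congr_fun he x
  have h2 : e' (W.T y) = W'.T (e' y) := LinearMap.congr_fun he' y
  change TensorProduct.congr e e' (V.T x ⊗ₜ[F] y + x ⊗ₜ[F] W.T y)
    = V'.T (e x) ⊗ₜ[F] e' y + e x ⊗ₜ[F] W'.T (e' y)
  simp [h1, h2]

theorem tensor_comm (V W : NilMod F) : Iso (V.tensor W) (W.tensor V) :=
  ⟨TensorProduct.comm F _ _, TensorProduct.ext' fun x y => by
    change TensorProduct.comm F V.carrier W.carrier (V.T x ⊗ₜ[F] y + x ⊗ₜ[F] W.T y)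
      = W.T y ⊗ₜ[F] x + y ⊗ₜ[F] V.T x
    simp [add_comm]⟩

theorem tensor_assoc (U V W : NilMod F) :
    Iso ((U.tensor V).tensor W) (U.tensor (V.tensor W)) :=
  ⟨TensorProduct.assoc F _ _ _, TensorProduct.ext_threefold fun x y z => by
    change TensorProduct.assoc F U.carrier V.carrier W.carrier
        ((U.T x ⊗ₜ[F] y + x ⊗ₜ[F] V.T y) ⊗ₜ[F] z + (x ⊗ₜ[F] y) ⊗ₜ[F] W.T z)
      = U.T x ⊗ₜ[F] (y ⊗ₜ[F] z) + x ⊗ₜ[F] (V.T y ⊗ₜ[F] z + y ⊗ₜ[F] W.T z)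
    simp [TensorProduct.add_tmul, TensorProduct.tmul_add, add_assoc]⟩

theorem unit_tensor (V : NilMod F) : Iso ((unit F).tensor V) V :=
  ⟨TensorProduct.lid F _, TensorProduct.ext' fun (x : F) y => by
    change TensorProduct.lid F V.carrier ((0 : F) ⊗ₜ[F] y + x ⊗ₜ[F] V.T y) = V.T (x • y)
    simp⟩

theorem sum_tensor (U V W : NilMod F) :
    Iso ((U.sum V).tensor W) ((U.tensor W).sum (V.tensor W)) := by
  refine ⟨TensorProduct.prodLeft F F U.carrier V.carrier W.carrier, TensorProduct.ext' ?_⟩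
  rintro ⟨x, y⟩ z
  change TensorProduct.prodLeft F F U.carrier V.carrier W.carrier
      ((U.T x, V.T y) ⊗ₜ[F] z + (x, y) ⊗ₜ[F] W.T z)
    = (U.T x ⊗ₜ[F] z + x ⊗ₜ[F] W.T z, V.T y ⊗ₜ[F] z + y ⊗ₜ[F] W.T z)
  rw [map_add, TensorProduct.prodLeft_tmul, TensorProduct.prodLeft_tmul]
  rfl

end NilMod

/-- Isomorphism classes of finitely generated `T`-power-torsion `F[T]`-modules. -/
def NilClass (F : Type u) [Field F] : Type (u + 1) := Quotient (NilMod.setoid F)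

namespace NilClass

variable {F : Type u} [Field F]

/-- Direct sum of isomorphism classes. -/
def sum : NilClass F → NilClass F → NilClass F :=
  Quotient.map₂ NilMod.sum fun _ _ h _ _ h' => NilMod.Iso.sum h h'

/-- Isomorphism classes form a commutative monoid under the tensor product over `F`. -/
instance : CommMonoid (NilClass F) where
  mul := Quotient.map₂ NilMod.tensor fun _ _ h _ _ h' => NilMod.Iso.tensor h h'
  one := Quotient.mk _ (NilMod.unit F)
  mul_assoc := by
    rintro ⟨U⟩ ⟨V⟩ ⟨W⟩
    exact Quotient.sound (NilMod.tensor_assoc U V W)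
  mul_comm := by
    rintro ⟨V⟩ ⟨W⟩
    exact Quotient.sound (NilMod.tensor_comm V W)
  one_mul := by
    rintro ⟨V⟩
    exact Quotient.sound (NilMod.unit_tensor V)
  mul_one := by
    rintro ⟨V⟩
    exact Quotient.sound ((NilMod.tensor_comm V (NilMod.unit F)).trans (NilMod.unit_tensor V))

end NilClass

/-- The Grothendieck relations `[V ⊕ W] - [V] - [W]`. They are stable under multiplication by
classes, since the tensor product distributes over direct sums (`NilMod.sum_tensor`), so that the ideal they generate
is just the subgroup they generate. -/
def grothendieckIdeal (F : Type u) [Field F] : Ideal (FreeAbelianGroup (NilClass F)) :=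
  Ideal.span {x | ∃ V W : NilClass F, x = FreeAbelianGroup.of (V.sum W)
    - FreeAbelianGroup.of V - FreeAbelianGroup.of W}

/-- The Grothendieck ring `Γ`: the free abelian group on the isomorphism classes, modulo
`[V ⊕ W] = [V] + [W]`, with the product `[V] [W] = [V ⊗_F W]`. -/
abbrev Gamma (F : Type u) [Field F] : Type (u + 1) :=
  FreeAbelianGroup (NilClass F) ⧸ grothendieckIdeal F

/-- The class of a module in `Γ`. -/
def Gamma.cls {F : Type u} [Field F] (V : NilMod F) : Gamma F :=
  Ideal.Quotient.mk (grothendieckIdeal F)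
    (FreeAbelianGroup.of (Quotient.mk (NilMod.setoid F) V : NilClass F))

/-- `λ_i = (-1) ^ i ([F[T] / T ^ (i + 1)] - [F[T] / T ^ i])`. This is the only family such that
`[V] = ∑ i, (-1) ^ i dim (T ^ i V / T ^ (i + 1) V) λ_i` for all `V`: apply this to the cyclic
modules, for which it says `[F[T] / T ^ r] = ∑ i < r, (-1) ^ i λ_i`. -/
def Gamma.lam (F : Type u) [Field F] (i : ℕ) : Gamma F :=
  (-1) ^ i * (Gamma.cls (NilMod.cyclic F (i + 1)) - Gamma.cls (NilMod.cyclic F i))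

/-- `Γ_ℚ = Γ ⊗_ℤ ℚ`. -/
abbrev GammaQ (F : Type u) [Field F] : Type (u + 1) := Gamma F ⊗[ℤ] ℚ

/-- `L_n (α) = ∑_{i < q} (α ((i + 1) / q) - α (i / q)) (-1) ^ i λ_i`, with `q = 2 ^ n`. -/
def scriptL (F : Type u) [Field F] (n : ℕ) (α : DyadicFun) : GammaQ F :=
  ∑ i : Fin (2 ^ n), Gamma.lam F i ⊗ₜ[ℤ]
    ((α (DyadicI.node n (i + 1) i.2) - α (DyadicI.node n i i.2.le)) * (-1) ^ (i : ℕ))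

end

/-!
Let `A_f = F[[u]] / (u ^ q)` with `q = 2 ^ n` and with `T` acting as the multiplication by `f`. The
numbers `q ^ r * φ_f (i / q)` are the coranks of the powers of `T` on `A_f`, and these determine the
class of `A_f`: with `r` variables, `L_n (φ_f) = q ^ (-r) [A_f]`. (That the value of `φ_f` at a
dyadic fraction does not depend on how it is written comes from the Frobenius.) As `A_h` is
`A_f ⊗ A_g`, with `T` acting as on a tensor product in `Γ`, the elements `L_n` multiply.

For the second claim put `μ_i = (-1) ^ i λ_i`. In characteristic `2` one has, for `q = 2 ^ n` and
`i < q`, that `μ_q μ_i = μ_(q + i)` and `μ_q ^ 2 = 1`. Hence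
`L_(n + 1) (α) = L_n (α₀) + μ_q L_n (α₁)`, and the recursion defining `α # β` becomes the
multiplication of such expressions, so that `L_n (α # β) = L_n (α) L_n (β)`. The `μ_i` being
linearly independent, `α` is determined by `α 0` and all the `L_n (α)`.

The products of the `μ_i` are found by comparing rank jumps, i.e. the dimensions of
`T ^ k V / T ^ (k + 1) V`, which are antitone in `k` and determine a class in `Γ`. The key point is
that `F[T] / T ^ q ⊗ W` is free over `F[T] / T ^ q` if `T ^ q W = 0`, while the jumps of
`F[T] / T ^ (q - 1) ⊗ F[T] / T ^ j` at `k < q` lie in `{j - 1, j}` if `0 < j ≤ q`.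
-/

noncomputable section

universe u

/-! ### Rank jumps of nilpotent endomorphisms -/

theorem prodMap_pow {R M N : Type*} [CommSemiring R] [AddCommMonoid M] [Module R M]
    [AddCommMonoid N] [Module R N] (f : Module.End R M) (g : Module.End R N) (k : ℕ) :
    (f.prodMap g : Module.End R (M × N)) ^ k = (f ^ k).prodMap (g ^ k) :=
  (map_pow (LinearMap.prodMapRingHom R M N) (f, g) k).symm

theorem finrank_range_prodMap {K M N M' N' : Type*} [Field K] [AddCommGroup M] [Module K M]
    [AddCommGroup N] [Module K N] [AddCommGroup M'] [Module K M'] [FiniteDimensional K M']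
    [AddCommGroup N'] [Module K N'] [FiniteDimensional K N'] (f : M →ₗ[K] M') (g : N →ₗ[K] N') :
    Module.finrank K (LinearMap.range (f.prodMap g)) =
      Module.finrank K (LinearMap.range f) + Module.finrank K (LinearMap.range g) := by
  have h : LinearMap.range (f.prodMap g) =
      LinearMap.range ((LinearMap.range f).subtype.prodMap (LinearMap.range g).subtype) := by
    simp only [LinearMap.range_prodMap, Submodule.range_subtype]
  rw [h, LinearMap.finrank_range_of_inj, Module.finrank_prod]
  exact (Submodule.subtype_injective _).prodMap (Submodule.subtype_injective _)

theorem antitone_eq_ite_lt_sum {b : ℕ → ℤ} (hb : Antitone b) {q : ℕ} (h0 : ∀ k < q, 0 ≤ b k)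
    (h1 : ∀ k < q, b k ≤ 1) {k : ℕ} (hk : k < q) :
    b k = if (k : ℤ) < ∑ j ∈ Finset.range q, b j then 1 else 0 := by
  have hsplit := Finset.sum_range_add_sum_Ico b hk.le
  have h0k := h0 k hk
  have h1k := h1 k hk
  obtain hbk | hbk : b k = 0 ∨ b k = 1 := by omega
  · have htail : ∑ j ∈ Finset.Ico k q, b j ≤ 0 :=
      Finset.sum_nonpos fun j hj => (hb (Finset.mem_Ico.1 hj).1).trans hbk.le
    have hhead : ∑ j ∈ Finset.range k, b j ≤ k := by
      simpa using Finset.sum_le_card_nsmul (Finset.range k) b 1 fun j hj =>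
        h1 j ((Finset.mem_range.1 hj).trans hk)
    rw [hbk, if_neg (by omega)]
  · have hhead : (k : ℤ) ≤ ∑ j ∈ Finset.range k, b j := by
      simpa using Finset.card_nsmul_le_sum (Finset.range k) b 1 fun j hj =>
        hbk.symm.le.trans (hb (Finset.mem_range.1 hj).le)
    have htail : b k ≤ ∑ j ∈ Finset.Ico k q, b j :=
      Finset.single_le_sum (fun j hj => h0 j (Finset.mem_Ico.1 hj).2) (Finset.left_mem_Ico.2 hk)
    rw [hbk, if_pos (by omega)]

namespace NilMod

variable {F : Type u} [Field F]

/-- The rank of `T ^ k`. -/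
def rk (V : NilMod F) (k : ℕ) : ℕ := Module.finrank F (LinearMap.range (V.T ^ k))

/-- The dimension of `T ^ k V / T ^ (k + 1) V`, i.e. the number of Jordan blocks of size greater
than `k`; an integer, so that it can be subtracted. -/
def jump (V : NilMod F) (k : ℕ) : ℤ := V.rk k - V.rk (k + 1)

/-- The dimension of the underlying vector space. -/
def dim (V : NilMod F) : ℕ := Module.finrank F V.carrier

theorem rk_zero (V : NilMod F) : V.rk 0 = V.dim := by
  rw [rk, pow_zero, Module.End.one_eq_id, LinearMap.range_id, finrank_top, dim]

theorem rk_eq_zero {V : NilMod F} {k : ℕ} (h : V.T ^ k = 0) : V.rk k = 0 := by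
  rw [rk, h, LinearMap.range_zero, finrank_bot]

theorem jump_eq_finrank_inf (V : NilMod F) (k : ℕ) :
    V.jump k = Module.finrank F ↥(LinearMap.range (V.T ^ k) ⊓ LinearMap.ker V.T) := by
  have hrange : LinearMap.range (V.T.domRestrict (LinearMap.range (V.T ^ k))) =
      LinearMap.range (V.T ^ (k + 1)) := by
    rw [LinearMap.range_domRestrict, ← LinearMap.range_comp, pow_succ', Module.End.mul_eq_comp]
  have hker : Module.finrank F
      (LinearMap.ker (V.T.domRestrict (LinearMap.range (V.T ^ k)))) =
      Module.finrank F ↥(LinearMap.range (V.T ^ k) ⊓ LinearMap.ker V.T) := by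
    rw [LinearMap.ker_domRestrict, ← Submodule.map_comap_subtype]
    exact (Submodule.equivMapOfInjective _ (Submodule.subtype_injective _) _).finrank_eq
  have h := LinearMap.finrank_range_add_finrank_ker (V.T.domRestrict (LinearMap.range (V.T ^ k)))
  rw [hrange, hker] at h
  rw [jump, rk, rk]
  omega

theorem jump_nonneg (V : NilMod F) (k : ℕ) : 0 ≤ V.jump k := by
  rw [jump_eq_finrank_inf]
  exact Nat.cast_nonneg _

theorem jump_antitone (V : NilMod F) : Antitone V.jump := by
  refine antitone_nat_of_succ_le fun k => ?_
  rw [jump_eq_finrank_inf, jump_eq_finrank_inf]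
  refine Nat.cast_le.2 (Submodule.finrank_mono (inf_le_inf_right _ ?_))
  rw [pow_succ, Module.End.mul_eq_comp]
  exact LinearMap.range_comp_le_range _ _

theorem sum_jump {V : NilMod F} {N : ℕ} (h : V.T ^ N = 0) :
    ∑ k ∈ Finset.range N, V.jump k = V.dim := by
  refine (Finset.sum_range_sub' (fun k => (V.rk k : ℤ)) N).trans ?_
  rw [rk_zero, rk_eq_zero h, Nat.cast_zero, sub_zero]

theorem jump_eq_zero {V : NilMod F} {N k : ℕ} (h : V.T ^ N = 0) (hk : N ≤ k) : V.jump k = 0 := by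
  rw [jump, rk_eq_zero (pow_eq_zero_of_le hk h), rk_eq_zero (pow_eq_zero_of_le (by omega) h),
    sub_self]

theorem jump_zero_le {V : NilMod F} {S : Submodule F V.carrier}
    (h : LinearMap.range V.T ⊔ S = ⊤) : V.jump 0 ≤ Module.finrank F S := by
  have h1 := Submodule.finrank_add_le_finrank_add_finrank (LinearMap.range V.T) S
  rw [h, finrank_top] at h1
  rw [jump, rk_zero, zero_add, rk, pow_one, dim]
  omega

theorem Iso.rk_eq {V W : NilMod F} (h : Iso V W) (k : ℕ) : V.rk k = W.rk k := by
  obtain ⟨e, he⟩ := h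
  have hk : (W.T ^ k) ∘ₗ e.toLinearMap = e.toLinearMap ∘ₗ (V.T ^ k) :=
    Module.End.commute_pow_left_of_commute he.symm k
  rw [rk, rk, ← LinearEquiv.range_comp e (W.T ^ k), hk, LinearMap.range_comp]
  exact (LinearEquiv.finrank_map_eq e _).symm

theorem Iso.jump_eq {V W : NilMod F} (h : Iso V W) (k : ℕ) : V.jump k = W.jump k := by
  rw [jump, jump, h.rk_eq, h.rk_eq]

theorem rk_sum (V W : NilMod F) (k : ℕ) : (V.sum W).rk k = V.rk k + W.rk k := by
  change Module.finrank F (LinearMap.range (V.T.prodMap W.T ^ k)) = _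
  rw [prodMap_pow, finrank_range_prodMap, rk, rk]

theorem jump_sum (V W : NilMod F) (k : ℕ) : (V.sum W).jump k = V.jump k + W.jump k := by
  simp only [jump, rk_sum]
  push_cast
  ring

end NilMod

/-! ### Additive functions on `Γ` -/

theorem NilClass.mul_sum {F : Type u} [Field F] (U V W : NilClass F) :
    U * V.sum W = (U * V).sum (U * W) := by
  rw [mul_comm U, mul_comm U, mul_comm U]
  induction U, V using Quotient.inductionOn₂
  induction W using Quotient.inductionOn
  exact Quotient.sound (NilMod.sum_tensor _ _ _)

namespace Gamma

variable {F : Type u} [Field F] {A : Type*} [AddCommGroup A]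

theorem freeLift_eq_zero {φ : NilClass F → A} (hφ : ∀ V W, φ (V.sum W) = φ V + φ W)
    {x : FreeAbelianGroup (NilClass F)} (hx : x ∈ grothendieckIdeal F) :
    FreeAbelianGroup.lift φ x = 0 := by
  suffices h : ∀ y, FreeAbelianGroup.lift φ (y * x) = 0 by simpa only [one_mul] using h 1
  induction hx using Submodule.span_induction with
  | mem x hx =>
    obtain ⟨V, W, rfl⟩ := hx
    intro y
    induction y using FreeAbelianGroup.induction_on with
    | zero => rw [zero_mul, map_zero]
    | of U =>
      simp only [mul_sub, ← FreeAbelianGroup.of_mul, map_sub, FreeAbelianGroup.lift_apply_of,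
        NilClass.mul_sum, hφ]
      abel
    | neg U ih => rw [neg_mul, map_neg, ih, neg_zero]
    | add x y ihx ihy => rw [add_mul, map_add, ihx, ihy, add_zero]
  | zero => simp only [mul_zero, map_zero, implies_true]
  | add a b _ _ ha hb => simp only [mul_add, map_add, ha, hb, add_zero, implies_true]
  | smul a b _ hb => simp only [smul_eq_mul, ← mul_assoc, hb, implies_true]

/-- The universal property of `Γ` as a Grothendieck group: a function of isomorphism classes which
is additive on direct sums extends to a homomorphism. -/
def lift (φ : NilClass F → A) (hφ : ∀ V W, φ (V.sum W) = φ V + φ W) : Gamma F →+ A :=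
  QuotientAddGroup.lift (grothendieckIdeal F).toAddSubgroup (FreeAbelianGroup.lift φ)
    fun _ hx => freeLift_eq_zero hφ hx

theorem lift_cls (φ : NilClass F → A) (hφ : ∀ V W, φ (V.sum W) = φ V + φ W) (V : NilMod F) :
    lift φ hφ (cls V) = φ (Quotient.mk (NilMod.setoid F) V) :=
  FreeAbelianGroup.lift_apply_of φ _

/-- The homomorphism `Γ → ℤ` sending `[V]` to `dim (T ^ k V / T ^ (k + 1) V)`. -/
def jump (F : Type u) [Field F] (k : ℕ) : Gamma F →+ ℤ :=
  lift (Quotient.lift (fun V => V.jump k) fun _ _ h => NilMod.Iso.jump_eq h k) <| by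
    rintro ⟨V⟩ ⟨W⟩
    exact NilMod.jump_sum V W k

theorem jump_cls (k : ℕ) (V : NilMod F) : jump F k (cls V) = V.jump k :=
  lift_cls _ _ V

theorem cls_eq {V W : NilMod F} (h : V.Iso W) : cls V = cls W := by
  rw [cls, cls, Quotient.sound (s := NilMod.setoid F) h]

theorem cls_sum (V W : NilMod F) : cls (V.sum W) = cls V + cls W := by
  rw [← sub_eq_zero, ← sub_sub]
  exact Ideal.Quotient.eq_zero_iff_mem.2 (Ideal.subset_span ⟨_, _, rfl⟩)

theorem cls_tensor (V W : NilMod F) : cls (V.tensor W) = cls V * cls W :=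
  (congrArg (Ideal.Quotient.mk (grothendieckIdeal F))
    (FreeAbelianGroup.of_mul (α := NilClass F) (Quotient.mk (NilMod.setoid F) V)
      (Quotient.mk (NilMod.setoid F) W))).trans (map_mul _ _ _)

theorem cls_unit : cls (NilMod.unit F) = 1 := rfl

theorem cls_eq_zero (V : NilMod F) [Subsingleton V.carrier] : cls V = 0 := by
  have : Subsingleton (V.sum V).carrier := inferInstanceAs (Subsingleton (V.carrier × V.carrier))
  have h : V.Iso (V.sum V) :=
    ⟨LinearEquiv.ofSubsingleton _ _, LinearMap.ext fun _ => Subsingleton.elim _ _⟩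
  exact left_eq_add.1 ((cls_eq h).trans (cls_sum V V))

end Gamma

/-! ### Decomposition into cyclic modules -/

namespace NilMod

variable {F : Type u} [Field F]

theorem dim_cyclic (m : ℕ) : (cyclic F m).dim = m :=
  finrank_quotient_span_eq_natDegree.trans (Polynomial.natDegree_X_pow m)

/-- The projection of `F[T]` onto the cyclic module. -/
def cyclicMk (F : Type u) [Field F] (m : ℕ) : Polynomial F →ₗ[F] (cyclic F m).carrier :=
  (Ideal.Quotient.mkₐ F (Ideal.span {(Polynomial.X : Polynomial F) ^ m})).toLinearMap

theorem cyclicMk_surjective (m : ℕ) : Function.Surjective (cyclicMk F m) :=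
  Ideal.Quotient.mk_surjective

theorem cyclic_T_mk (m : ℕ) (p : Polynomial F) :
    (cyclic F m).T (cyclicMk F m p) = cyclicMk F m (Polynomial.X * p) :=
  (map_mul (Ideal.Quotient.mk (Ideal.span {(Polynomial.X : Polynomial F) ^ m})) _ _).symm

theorem cyclic_T_pow_mk (m k : ℕ) (p : Polynomial F) :
    ((cyclic F m).T ^ k) (cyclicMk F m p) = cyclicMk F m (Polynomial.X ^ k * p) := by
  induction k with
  | zero => rw [pow_zero, pow_zero, one_mul, Module.End.one_apply]
  | succ k ih => rw [pow_succ', Module.End.mul_apply, ih, cyclic_T_mk, pow_succ', mul_assoc]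

theorem cyclic_T_pow (m : ℕ) : (cyclic F m).T ^ m = 0 := by
  refine LinearMap.ext fun x => ?_
  obtain ⟨p, rfl⟩ := cyclicMk_surjective m x
  rw [cyclic_T_pow_mk]
  exact Ideal.Quotient.eq_zero_iff_mem.2
    (Ideal.mul_mem_right _ _ (Ideal.mem_span_singleton_self _))

/-- The generator of the cyclic module. -/
def cyclicOne (F : Type u) [Field F] (m : ℕ) : (cyclic F m).carrier := cyclicMk F m 1

theorem span_cyclic_T_pow_cyclicOne (m : ℕ) :
    Submodule.span F (Set.range fun k => ((cyclic F m).T ^ k) (cyclicOne F m)) = ⊤ := by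
  refine eq_top_iff.2 fun x _ => ?_
  obtain ⟨p, rfl⟩ := cyclicMk_surjective m x
  induction p using Polynomial.induction_on' with
  | add p q hp hq => rw [map_add]; exact add_mem (hp trivial) (hq trivial)
  | monomial k a =>
    rw [← Polynomial.smul_X_eq_monomial, map_smul]
    refine Submodule.smul_mem _ a (Submodule.subset_span ⟨k, ?_⟩)
    change ((cyclic F m).T ^ k) (cyclicOne F m) = _
    rw [cyclicOne, cyclic_T_pow_mk, mul_one]

theorem range_cyclic_T_sup_span_cyclicOne (m : ℕ) :
    LinearMap.range (cyclic F m).T ⊔ Submodule.span F {cyclicOne F m} = ⊤ := by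
  rw [eq_top_iff, ← span_cyclic_T_pow_cyclicOne, Submodule.span_le]
  rintro _ ⟨_ | k, rfl⟩
  · exact Submodule.mem_sup_right (Submodule.mem_span_singleton_self _)
  · exact Submodule.mem_sup_left ⟨((cyclic F m).T ^ k) (cyclicOne F m), by
      rw [← Module.End.mul_apply, ← pow_succ']⟩

theorem jump_cyclic (m k : ℕ) : (cyclic F m).jump k = if k < m then 1 else 0 := by
  split_ifs with hk
  · have hle : ∀ j, (cyclic F m).jump j ≤ 1 := fun j =>
      ((jump_antitone _ (Nat.zero_le j)).trans
        (jump_zero_le (range_cyclic_T_sup_span_cyclicOne m))).trans (by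
          exact_mod_cast (finrank_span_le_card _).trans_eq (Set.toFinset_card _))
    have h := antitone_eq_ite_lt_sum (jump_antitone (cyclic F m))
      (fun j _ => jump_nonneg _ j) (fun j _ => hle j) hk
    rwa [sum_jump (cyclic_T_pow m), dim_cyclic, if_pos (by exact_mod_cast hk)] at h
  · exact jump_eq_zero (cyclic_T_pow m) (not_lt.1 hk)

/-- The direct sum of a finite family. -/
def pi {d : ℕ} (W : Fin d → NilMod F) : NilMod F where
  carrier := ∀ i, (W i).carrier
  T := LinearMap.pi fun i => (W i).T ∘ₗ LinearMap.proj i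
  nilpotent := by
    choose N hN using fun i => (W i).nilpotent
    have hpow : ∀ k x i, ((LinearMap.pi fun i => (W i).T ∘ₗ LinearMap.proj i :
        Module.End F (∀ i, (W i).carrier)) ^ k) x i = ((W i).T ^ k) (x i) := fun k => by
      induction k with
      | zero => exact fun _ _ => rfl
      | succ k ih => intro x i; rw [pow_succ, Module.End.mul_apply, ih, pow_succ]; rfl
    refine ⟨∑ i, N i, LinearMap.ext fun x => funext fun i => ?_⟩
    rw [hpow, pow_eq_zero_of_le (Finset.single_le_sum (fun _ _ => Nat.zero_le _)
      (Finset.mem_univ i)) (hN i), LinearMap.zero_apply, LinearMap.zero_apply, Pi.zero_apply]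

theorem sum_iso_pi {d : ℕ} (W : Fin (d + 1) → NilMod F) :
    Iso ((W 0).sum (pi fun i => W i.succ)) (pi W) :=
  ⟨Fin.consLinearEquiv F fun i => (W i).carrier,
    LinearMap.ext fun _ => funext (Fin.cases rfl fun _ => rfl)⟩

theorem exists_iso_pi (V : NilMod F) :
    ∃ (d : ℕ) (k : Fin d → ℕ), Iso V (pi fun i => cyclic F (k i)) := by
  obtain ⟨N, hN⟩ := V.nilpotent
  have htors : Module.IsTorsion' (Module.AEval' V.T)
      (Submonoid.powers (Polynomial.X : Polynomial F)) := fun x => by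
    refine ⟨⟨_, N, rfl⟩, ?_⟩
    obtain ⟨v, rfl⟩ := (Module.AEval'.of V.T).surjective x
    refine (Module.AEval'.X_pow_smul_of V.T v N).trans ?_
    rw [hN, zero_smul, map_zero]
  obtain ⟨d, k, ⟨e⟩⟩ := Module.torsion_by_prime_power_decomposition Polynomial.irreducible_X htors
  let e' := e.trans (DirectSum.linearEquivFunOnFintype (Polynomial F) (Fin d) _)
  refine ⟨d, k, (Module.AEval'.of V.T).trans (e'.restrictScalars F), LinearMap.ext fun v => ?_⟩
  change e' (Module.AEval'.of V.T (V.T v)) = _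
  rw [← Module.AEval'.X_smul_of, map_smul]
  rfl

end NilMod

namespace Gamma

variable {F : Type u} [Field F]

theorem cls_pi {d : ℕ} (W : Fin d → NilMod F) : cls (NilMod.pi W) = ∑ i, cls (W i) := by
  induction d with
  | zero =>
    have : Subsingleton (NilMod.pi W).carrier :=
      inferInstanceAs (Subsingleton (∀ i, (W i).carrier))
    rw [cls_eq_zero, Fin.sum_univ_zero]
  | succ d ih => rw [← cls_eq (NilMod.sum_iso_pi W), cls_sum, ih, Fin.sum_univ_succ]

theorem closure_cls_cyclic :
    AddSubgroup.closure (Set.range fun m => cls (NilMod.cyclic F m)) = ⊤ := by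
  refine eq_top_iff.2 fun x _ => ?_
  obtain ⟨x, rfl⟩ := Ideal.Quotient.mk_surjective x
  induction x using FreeAbelianGroup.induction_on with
  | zero => exact zero_mem _
  | of V =>
    induction V using Quotient.inductionOn with
    | h V =>
      obtain ⟨d, m, hV⟩ := V.exists_iso_pi
      change cls V ∈ _
      rw [cls_eq hV, cls_pi]
      exact sum_mem fun i _ => AddSubgroup.subset_closure ⟨m i, rfl⟩
  | neg V ih => rw [map_neg]; exact neg_mem (ih trivial)
  | add x y hx hy => rw [map_add]; exact add_mem (hx trivial) (hy trivial)

/-- The classes `μ_i = [F[T] / T ^ (i + 1)] - [F[T] / T ^ i]`, so that `λ_i = (-1) ^ i μ_i`. They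
form the basis of `Γ` dual to the rank jumps. -/
def mu (F : Type u) [Field F] (i : ℕ) : Gamma F :=
  cls (NilMod.cyclic F (i + 1)) - cls (NilMod.cyclic F i)

theorem cls_cyclic_zero : cls (NilMod.cyclic F 0) = 0 := by
  have : Subsingleton (NilMod.cyclic F 0).carrier :=
    Module.finrank_zero_iff.1 (NilMod.dim_cyclic (F := F) 0)
  exact cls_eq_zero _

theorem sum_mu (m : ℕ) : ∑ i ∈ Finset.range m, mu F i = cls (NilMod.cyclic F m) := by
  refine (Finset.sum_range_sub (fun i => cls (NilMod.cyclic F i)) m).trans ?_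
  rw [cls_cyclic_zero, sub_zero]

theorem jump_cls_cyclic (k m : ℕ) :
    jump F k (cls (NilMod.cyclic F m)) = if k < m then 1 else 0 := by
  rw [jump_cls, NilMod.jump_cyclic]

theorem jump_mu (k i : ℕ) : jump F k (mu F i) = if k = i then 1 else 0 := by
  rw [mu, map_sub, jump_cls_cyclic, jump_cls_cyclic]
  split_ifs <;> omega

open Filter in
theorem eventually_sum_jump_smul_mu (x : Gamma F) :
    ∀ᶠ N in atTop, ∑ k ∈ Finset.range N, jump F k x • mu F k = x := by
  have hx : x ∈ AddSubgroup.closure (Set.range fun m => cls (NilMod.cyclic F m)) := by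
    rw [closure_cls_cyclic]
    trivial
  induction hx using AddSubgroup.closure_induction with
  | mem x hx =>
    obtain ⟨m, rfl⟩ := hx
    filter_upwards [eventually_ge_atTop m] with N hN
    simp only [jump_cls_cyclic, ite_smul, one_smul, zero_smul]
    rw [← sum_mu, ← Finset.sum_filter]
    congr 1
    ext k
    simp only [Finset.mem_filter, Finset.mem_range]
    omega
  | zero => simp only [map_zero, zero_smul, Finset.sum_const_zero, eventually_true]
  | add x y _ _ hx hy =>
    filter_upwards [hx, hy] with N hx hy
    simp only [map_add, add_smul, Finset.sum_add_distrib, hx, hy]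
  | neg x _ hx =>
    filter_upwards [hx] with N hx
    simp only [map_neg, neg_smul, Finset.sum_neg_distrib, hx]

theorem ext_jump {x y : Gamma F} (h : ∀ k, jump F k x = jump F k y) : x = y := by
  obtain ⟨N, hx, hy⟩ :=
    ((eventually_sum_jump_smul_mu x).and (eventually_sum_jump_smul_mu y)).exists
  rw [← hx, ← hy]
  simp only [h]

theorem cls_eq_sum_jump {V : NilMod F} {N : ℕ} (hN : V.T ^ N = 0) :
    cls V = ∑ k ∈ Finset.range N, V.jump k • mu F k := by
  refine ext_jump fun k => ?_
  simp only [jump_cls, map_sum, map_zsmul, jump_mu, smul_eq_mul, mul_ite, mul_one, mul_zero,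
    Finset.sum_ite_eq, Finset.mem_range]
  split_ifs with hk
  · rfl
  · exact NilMod.jump_eq_zero hN (not_lt.1 hk)

theorem mu_zero : mu F 0 = 1 := by
  have hT : (NilMod.unit F).T ^ 1 = 0 := pow_one _
  have hdim : (NilMod.unit F).dim = 1 := Module.finrank_self F
  have hjump := NilMod.sum_jump hT
  have hcls := cls_eq_sum_jump hT
  rw [Finset.sum_range_one] at hjump hcls
  rw [← cls_unit, hcls, hjump, hdim, Nat.cast_one, one_smul]

end Gamma

/-! ### Tensor products in characteristic `p` -/

theorem commute_map_id_map_id {R M N : Type*} [CommSemiring R] [AddCommMonoid M] [Module R M]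
    [AddCommMonoid N] [Module R N] (f : Module.End R M) (g : Module.End R N) :
    Commute (TensorProduct.map f LinearMap.id : Module.End R (M ⊗[R] N))
      (TensorProduct.map LinearMap.id g) := by
  change _ * _ = _ * _
  rw [← TensorProduct.map_mul, ← TensorProduct.map_mul]
  rfl

namespace NilMod

variable {F : Type u} [Field F]

/-- Pure tensors in `V ⊗ W`, as a bilinear map. -/
def tmul (V W : NilMod F) : V.carrier →ₗ[F] W.carrier →ₗ[F] (V.tensor W).carrier :=
  TensorProduct.mk F V.carrier W.carrier

theorem dim_tensor (V W : NilMod F) : (V.tensor W).dim = V.dim * W.dim :=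
  Module.finrank_tensorProduct (R := F) (S := F)

theorem tensor_T_tmul (V W : NilMod F) (x : V.carrier) (w : W.carrier) :
    (V.tensor W).T (tmul V W x w) = tmul V W (V.T x) w + tmul V W x (W.T w) := rfl

theorem eq_top_of_tmul_mem {V W : NilMod F} {S : Submodule F (V.tensor W).carrier}
    (h : ∀ x w, tmul V W x w ∈ S) : S = ⊤ :=
  eq_top_iff.2 fun z _ => TensorProduct.induction_on (motive := fun z => z ∈ S) z S.zero_mem h
    fun _ _ => S.add_mem

theorem tensor_T_pow_tmul (V W : NilMod F) (n : ℕ) (x : V.carrier) (w : W.carrier) :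
    ((V.tensor W).T ^ n) (tmul V W x w) = ∑ k ∈ Finset.range (n + 1),
      n.choose k • tmul V W ((V.T ^ k) x) ((W.T ^ (n - k)) w) := by
  refine (LinearMap.congr_fun ((commute_map_id_map_id V.T W.T).add_pow n) (x ⊗ₜ w)).trans ?_
  rw [LinearMap.sum_apply]
  refine Finset.sum_congr rfl fun k _ => ?_
  rw [← nsmul_eq_mul', LinearMap.smul_apply, TensorProduct.map_pow, TensorProduct.map_pow,
    ← TensorProduct.map_mul, TensorProduct.map_tmul, ← Module.End.one_eq_id, one_pow, mul_one,
    ← Module.End.one_eq_id, one_pow, one_mul]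
  rfl

theorem tensor_T_pow_char_pow {p : ℕ} [Fact p.Prime] [CharP F p] {V W : NilMod F} {n : ℕ}
    (hV : V.T ^ p ^ n = 0) (hW : W.T ^ p ^ n = 0) : (V.tensor W).T ^ p ^ n = 0 := by
  obtain ⟨r, hr⟩ := (commute_map_id_map_id V.T W.T).exists_add_pow_prime_pow_eq
    (Fact.out : p.Prime) n
  have hp : (p : Module.End F (V.carrier ⊗[F] W.carrier)) = 0 := by
    rw [← map_natCast (algebraMap F _), CharP.cast_eq_zero, map_zero]
  rw [TensorProduct.map_pow, TensorProduct.map_pow, hV, hW, TensorProduct.map_zero_left,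
    TensorProduct.map_zero_right, hp, zero_mul, zero_mul, zero_mul, add_zero, add_zero] at hr
  exact hr

theorem range_tensor_T_sup_range_tmul_cyclicOne (m : ℕ) (W : NilMod F) :
    LinearMap.range ((cyclic F m).tensor W).T ⊔
      LinearMap.range (tmul (cyclic F m) W (cyclicOne F m)) = ⊤ := by
  refine eq_top_of_tmul_mem fun x w => ?_
  have hx : x ∈ Submodule.span F (Set.range fun k => ((cyclic F m).T ^ k) (cyclicOne F m)) := by
    rw [span_cyclic_T_pow_cyclicOne]
    trivial
  induction hx using Submodule.span_induction with
  | mem x hx =>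
    obtain ⟨k, rfl⟩ := hx
    dsimp only
    induction k generalizing w with
    | zero => exact Submodule.mem_sup_right ⟨w, rfl⟩
    | succ k ih =>
      -- modulo the range of `T`, one has `T x ⊗ w = - x ⊗ T w`
      rw [pow_succ', Module.End.mul_apply, eq_sub_of_add_eq (tensor_T_tmul _ W _ w).symm]
      exact sub_mem (Submodule.mem_sup_left ⟨_, rfl⟩) (ih (W.T w))
  | zero => rw [map_zero, LinearMap.zero_apply]; exact zero_mem _
  | add x y _ _ hx hy => rw [map_add, LinearMap.add_apply]; exact add_mem hx hy
  | smul c x _ hx => rw [map_smul, LinearMap.smul_apply]; exact Submodule.smul_mem _ c hx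

theorem jump_cyclic_tensor_le (m : ℕ) (W : NilMod F) (k : ℕ) :
    ((cyclic F m).tensor W).jump k ≤ W.dim :=
  ((jump_antitone _ (Nat.zero_le k)).trans
    (jump_zero_le (range_tensor_T_sup_range_tmul_cyclicOne m W))).trans
      (Nat.cast_le.2 (LinearMap.finrank_range_le _))

theorem exists_cyclic_functional (m : ℕ) : ∃ π : (cyclic F (m + 1)).carrier →ₗ[F] F, ∀ k,
    π (((cyclic F (m + 1)).T ^ k) (cyclicOne F (m + 1))) = if k = m then 1 else 0 := by
  let I := Ideal.span {(Polynomial.X : Polynomial F) ^ (m + 1)}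
  have hI : I.restrictScalars F ≤ LinearMap.ker (Polynomial.lcoeff F m) := fun p hp => by
    obtain ⟨g, rfl⟩ := Ideal.mem_span_singleton'.1 hp
    rw [LinearMap.mem_ker, Polynomial.lcoeff_apply, Polynomial.coeff_mul_X_pow', if_neg (by omega)]
  let π : (cyclic F (m + 1)).carrier →ₗ[F] F :=
    ((I.restrictScalars F).liftQ (Polynomial.lcoeff F m) hI) ∘ₗ
      (Submodule.Quotient.restrictScalarsEquiv F I).symm.toLinearMap
  have hπ : ∀ p, π (cyclicMk F (m + 1) p) = p.coeff m := fun p => rfl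
  refine ⟨π, fun k => ?_⟩
  rw [cyclicOne, cyclic_T_pow_mk, hπ, mul_one, Polynomial.coeff_X_pow]
  simp only [eq_comm]

theorem rk_one_le_rk_cyclic_tensor {m : ℕ} (hm : (m : F) ≠ 0) (W : NilMod F) :
    W.rk 1 ≤ ((cyclic F m).tensor W).rk m := by
  obtain _ | m := m
  · exact absurd Nat.cast_zero hm
  obtain ⟨π, hπ⟩ := exists_cyclic_functional (F := F) m
  let ψ : ((cyclic F (m + 1)).tensor W).carrier →ₗ[F] W.carrier :=
    (TensorProduct.lid F W.carrier).toLinearMap ∘ₗ π.rTensor W.carrier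
  have hψ : ∀ x w, ψ (tmul _ _ x w) = π x • w := fun x w => rfl
  -- the component of `T ^ (m + 1) (1 ⊗ w)` along the top basis vector `T ^ m` is `(m + 1) T w`
  have h : ((m + 1 : ℕ) : F) • W.T = ψ ∘ₗ (((cyclic F (m + 1)).tensor W).T ^ (m + 1)) ∘ₗ
      tmul _ W (cyclicOne F (m + 1)) := by
    refine LinearMap.ext fun w => ?_
    rw [LinearMap.comp_apply, LinearMap.comp_apply, tensor_T_pow_tmul, map_sum,
      Finset.sum_eq_single m]
    · rw [map_nsmul, hψ, hπ, if_pos rfl, one_smul, Nat.choose_succ_self_right,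
        Nat.add_sub_cancel_left, pow_one, Nat.cast_smul_eq_nsmul, LinearMap.smul_apply]
    · intro k _ hkm
      rw [map_nsmul, hψ, hπ, if_neg hkm, zero_smul, smul_zero]
    · exact fun hk => absurd (Finset.mem_range.2 (by omega)) hk
  rw [rk, pow_one, ← LinearMap.range_smul W.T _ hm, h, rk, LinearMap.range_comp,
    LinearMap.range_comp]
  exact (Submodule.finrank_map_le _ _).trans (Submodule.finrank_mono LinearMap.map_le_range)

section CharP

variable {p : ℕ} [Fact p.Prime] [CharP F p] {n j : ℕ}

theorem jump_cyclic_tensor {W : NilMod F} (hW : W.T ^ p ^ n = 0) (k : ℕ) :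
    ((cyclic F (p ^ n)).tensor W).jump k = if k < p ^ n then (W.dim : ℤ) else 0 := by
  have hT := tensor_T_pow_char_pow (cyclic_T_pow (F := F) (p ^ n)) hW
  split_ifs with hk
  · refine (Finset.sum_eq_sum_iff_of_le fun k _ => jump_cyclic_tensor_le (p ^ n) W k).1 ?_ k
      (Finset.mem_range.2 hk)
    rw [sum_jump hT, dim_tensor, dim_cyclic, Finset.sum_const, Finset.card_range, Nat.cast_mul,
      nsmul_eq_mul]
  · exact jump_eq_zero hT (not_lt.1 hk)

theorem rk_one_cyclic (j : ℕ) : (cyclic F j).rk 1 = j - 1 := by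
  have h := jump_cyclic (F := F) j 0
  rw [jump, rk_zero, dim_cyclic, zero_add] at h
  split_ifs at h <;> omega

theorem cyclic_pred_tensor_cyclic_T_pow (hj : j ≤ p ^ n) :
    ((cyclic F (p ^ n - 1)).tensor (cyclic F j)).T ^ p ^ n = 0 :=
  tensor_T_pow_char_pow (pow_eq_zero_of_le (Nat.sub_le _ _) (cyclic_T_pow _))
    (pow_eq_zero_of_le hj (cyclic_T_pow _))

theorem pred_le_jump_cyclic_pred_tensor (hj : j ≤ p ^ n) {k : ℕ} (hk : k < p ^ n) :
    ((j - 1 : ℕ) : ℤ) ≤ ((cyclic F (p ^ n - 1)).tensor (cyclic F j)).jump k := by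
  rcases eq_or_ne n 0 with rfl | hn
  · rw [show j - 1 = 0 by rw [pow_zero] at hj; omega]
    exact jump_nonneg _ k
  have hq : 0 < p ^ n := pow_pos (Fact.out : p.Prime).pos n
  have hcast : ((p ^ n - 1 : ℕ) : F) ≠ 0 := by
    rw [Nat.cast_pred hq, Nat.cast_pow, CharP.cast_eq_zero, zero_pow hn, zero_sub]
    exact neg_ne_zero.2 one_ne_zero
  have hrk := rk_one_le_rk_cyclic_tensor hcast (cyclic F j)
  rw [rk_one_cyclic] at hrk
  refine le_trans ?_ (jump_antitone _ (Nat.le_sub_one_of_lt hk))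
  rw [jump, Nat.sub_add_cancel hq, rk_eq_zero (cyclic_pred_tensor_cyclic_T_pow hj), Nat.cast_zero,
    sub_zero]
  exact_mod_cast hrk

theorem jump_cyclic_pred_tensor_cyclic (hj0 : 0 < j) (hj : j ≤ p ^ n) (k : ℕ) :
    ((cyclic F (p ^ n - 1)).tensor (cyclic F j)).jump k =
      (if k < p ^ n then (j : ℤ) - 1 else 0) + if k < p ^ n - j then 1 else 0 := by
  set V := (cyclic F (p ^ n - 1)).tensor (cyclic F j)
  have hT : V.T ^ p ^ n = 0 := cyclic_pred_tensor_cyclic_T_pow hj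
  by_cases hk : k < p ^ n
  · have hle : ∀ i, V.jump i ≤ j := fun i =>
      (jump_cyclic_tensor_le _ _ i).trans_eq (congrArg _ (dim_cyclic j))
    have hge : ∀ i < p ^ n, (j : ℤ) - 1 ≤ V.jump i := fun i hi => by
      have h : ((j - 1 : ℕ) : ℤ) ≤ V.jump i := pred_le_jump_cyclic_pred_tensor hj hi
      omega
    have hsum : ∑ i ∈ Finset.range (p ^ n), (V.jump i - (j - 1)) = (p ^ n - j : ℕ) := by
      rw [Finset.sum_sub_distrib, sum_jump hT, dim_tensor, dim_cyclic, dim_cyclic,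
        Finset.sum_const, Finset.card_range, nsmul_eq_mul, Nat.cast_mul, Nat.cast_sub hj,
        Nat.cast_sub (hj0.trans_le hj), Nat.cast_one]
      ring
    have hb : Antitone fun i => V.jump i - (j - 1) := fun a b hab =>
      sub_le_sub_right (V.jump_antitone hab) _
    have h := antitone_eq_ite_lt_sum hb (fun i hi => sub_nonneg.2 (hge i hi))
      (fun i _ => by linarith [hle i]) hk
    rw [hsum] at h
    simp only [Nat.cast_lt] at h
    rw [if_pos hk, ← h, add_sub_cancel]
  · rw [jump_eq_zero hT (not_lt.1 hk), if_neg hk, if_neg (by omega), add_zero]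

end CharP

end NilMod

namespace Gamma

variable {F : Type u} [Field F]

section CharP

variable {p : ℕ} [Fact p.Prime] [CharP F p] {n j : ℕ}

theorem mu_pred_mul_cls_cyclic (hj : j ≤ p ^ n) :
    mu F (p ^ n - 1) * cls (NilMod.cyclic F j) =
      cls (NilMod.cyclic F (p ^ n)) - cls (NilMod.cyclic F (p ^ n - j)) := by
  rcases Nat.eq_zero_or_pos j with rfl | hj0
  · rw [cls_cyclic_zero, mul_zero, Nat.sub_zero, sub_self]
  have hq : p ^ n - 1 + 1 = p ^ n := by omega
  refine ext_jump fun k => ?_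
  rw [mu, hq, sub_mul, ← cls_tensor, ← cls_tensor, map_sub, map_sub, jump_cls, jump_cls,
    NilMod.jump_cyclic_tensor (pow_eq_zero_of_le hj (NilMod.cyclic_T_pow _)), NilMod.dim_cyclic,
    NilMod.jump_cyclic_pred_tensor_cyclic hj0 hj, jump_cls_cyclic, jump_cls_cyclic]
  split_ifs <;> ring

theorem mu_pred_mul_mu (hj : j < p ^ n) :
    mu F (p ^ n - 1) * mu F j = mu F (p ^ n - 1 - j) := by
  have h : p ^ n - 1 - j = p ^ n - (j + 1) := by omega
  have h' : p ^ n - (j + 1) + 1 = p ^ n - j := by omega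
  rw [mu.eq_1 F j, mul_sub, mu_pred_mul_cls_cyclic hj, mu_pred_mul_cls_cyclic hj.le, h,
    sub_sub_sub_cancel_left, mu, h']

theorem mu_pred_mul_self : mu F (p ^ n - 1) * mu F (p ^ n - 1) = 1 := by
  have hq : 0 < p ^ n := pow_pos (Fact.out : p.Prime).pos n
  rw [mu_pred_mul_mu (by omega), Nat.sub_self, mu_zero]

end CharP

variable [CharP F 2] {n i : ℕ}

theorem mu_two_pow : mu F (2 ^ n) = mu F (2 ^ (n + 1) - 1) * mu F (2 ^ n - 1) := by
  have hq := Nat.two_pow_pos n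
  rw [mu_pred_mul_mu (by omega)]
  congr 1
  omega

theorem mu_two_pow_mul_mu (hi : i < 2 ^ n) : mu F (2 ^ n) * mu F i = mu F (2 ^ n + i) := by
  rw [mu_two_pow, mul_assoc, mu_pred_mul_mu hi, mu_pred_mul_mu (by omega)]
  congr 1
  omega

theorem mu_two_pow_mul_self : mu F (2 ^ n) * mu F (2 ^ n) = 1 := by
  rw [mu_two_pow, mul_mul_mul_comm, mu_pred_mul_self, mu_pred_mul_self, one_mul]

end Gamma

/-! ### The product `#` and the elements `L_n` -/

namespace DyadicI

theorem half_zero : zero.half = zero :=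
  Subtype.ext (by simp [half, zero])

theorem half_one : one.half = zero.halfSucc :=
  Subtype.ext (by simp [half, halfSucc, one, zero])

theorem halfSucc_one : one.halfSucc = one :=
  Subtype.ext (by norm_num [halfSucc, one])

theorem double_half (t : DyadicI) (h : t.half.1 ≤ 1 / 2) : t.half.double h = t :=
  Subtype.ext (by simp only [double, half]; ring)

theorem doublePred_halfSucc (t : DyadicI) (h : 1 / 2 ≤ t.halfSucc.1) :
    t.halfSucc.doublePred h = t :=
  Subtype.ext (by simp only [doublePred, halfSucc]; ring)

theorem node_zero (n : ℕ) : node n 0 (Nat.zero_le _) = zero :=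
  Subtype.ext (by simp [node, zero])

theorem node_two_pow (n : ℕ) : node n (2 ^ n) le_rfl = one :=
  Subtype.ext (by simp [node, one])

theorem half_node (n i : ℕ) (hi : i ≤ 2 ^ n) (hi' : i ≤ 2 ^ (n + 1)) :
    (node n i hi).half = node (n + 1) i hi' :=
  Subtype.ext (by simp only [half, node, pow_succ]; field_simp)

theorem halfSucc_node (n i : ℕ) (hi : i ≤ 2 ^ n) (hi' : 2 ^ n + i ≤ 2 ^ (n + 1)) :
    (node n i hi).halfSucc = node (n + 1) (2 ^ n + i) hi' :=
  Subtype.ext (by simp only [halfSucc, node, pow_succ]; push_cast; field_simp)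

theorem exists_eq_node (t : DyadicI) : ∃ (n i : ℕ) (hi : i ≤ 2 ^ n), t = node n i hi := by
  obtain ⟨_, h0, h1, n, k, rfl⟩ := t
  have hk0 : 0 ≤ k := by
    rw [le_div_iff₀ (by positivity), zero_mul] at h0
    exact_mod_cast h0
  lift k to ℕ using hk0
  rw [div_le_one (by positivity)] at h1
  exact ⟨n, k, by exact_mod_cast h1, Subtype.ext rfl⟩

theorem exists_eq_num_mul_eq_den_mul (n i : ℕ) (hi : i ≤ 2 ^ n) :
    ∃ m, i = (node n i hi).1.num.toNat * 2 ^ m ∧ 2 ^ n = (node n i hi).1.den * 2 ^ m := by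
  obtain ⟨c, hnum, hden⟩ := Rat.exists_eq_mul_div_num_and_eq_mul_div_den i
    (pow_ne_zero n two_ne_zero : (2 : ℤ) ^ n ≠ 0)
  have hq : ((i : ℤ) : ℚ) / ((2 ^ n : ℤ) : ℚ) = (node n i hi).1 := by push_cast; rfl
  rw [hq] at hnum hden
  set t := node n i hi
  have hc : 0 < c := pos_of_mul_pos_left (hden ▸ pow_pos two_pos n) (Int.natCast_nonneg _)
  lift c to ℕ using hc.le
  have hden' : 2 ^ n = c * t.1.den := by exact_mod_cast hden
  obtain ⟨m, -, rfl⟩ := (Nat.dvd_prime_pow Nat.prime_two).1 (Dvd.intro _ hden'.symm)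
  refine ⟨m, ?_, by rw [hden', mul_comm]⟩
  rw [← Int.toNat_of_nonneg (Rat.num_nonneg.2 t.2.1)] at hnum
  rw [mul_comm]
  exact_mod_cast hnum

end DyadicI

namespace DyadicFun

open DyadicI

theorem sharp_zero (α β : DyadicFun) : sharp α β zero = 0 := by
  rw [sharp]
  exact dif_pos rfl

theorem sharp_one (α β : DyadicFun) :
    sharp α β one = (α one - α zero) * (β one - β zero) := by
  rw [sharp]
  exact (dif_neg one_ne_zero).trans (dif_pos rfl)

theorem sharp_half (α β : DyadicFun) (t : DyadicI) :
    sharp α β t.half = sharp (T0 α) (T0 β) t + sharp (T1 α) (T1 β) t := by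
  rcases eq_or_ne t.1 0 with h0 | h0
  · obtain rfl : t = zero := Subtype.ext h0
    simp only [half_zero, sharp_zero, add_zero]
  · have hle : t.half.1 ≤ 1 / 2 := by
      have := t.2.2.1
      simp only [half]
      linarith
    rw [sharp, dif_neg (by simpa [half] using h0), dif_neg (by linarith), dif_pos hle, double_half]

theorem sharp_halfSucc (α β : DyadicFun) (t : DyadicI) :
    sharp α β t.halfSucc = sharp (T0 α) (T0 β) one + sharp (T1 α) (T1 β) one
      + sharp (T0 α) (T1 β) t + sharp (T1 α) (T0 β) t := by
  rcases eq_or_ne t.1 0 with h0 | h0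
  · obtain rfl : t = zero := Subtype.ext h0
    rw [← half_one, sharp_half, sharp_zero, sharp_zero, add_zero, add_zero]
  rcases eq_or_ne t.1 1 with h1 | h1
  · obtain rfl : t = one := Subtype.ext h1
    simp only [halfSucc_one, sharp_one, T0, T1, half_zero, ← half_one]
    ring
  · have hpos : 0 < t.1 := lt_of_le_of_ne t.2.1 h0.symm
    have hval : t.halfSucc.1 = (1 + t.1) / 2 := rfl
    rw [sharp, dif_neg (by linarith), dif_neg fun h => h1 (by linarith),
      dif_neg (by linarith)]
    simp only [doublePred_halfSucc]

theorem T0_sharp (α β : DyadicFun) :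
    T0 (sharp α β) = sharp (T0 α) (T0 β) + sharp (T1 α) (T1 β) :=
  funext fun t => sharp_half α β t

theorem T1_sharp (α β : DyadicFun) :
    T1 (sharp α β) = sharp (T0 α) (T1 β) + sharp (T1 α) (T0 β) +
      Function.const _ (sharp (T0 α) (T0 β) one + sharp (T1 α) (T1 β) one) :=
  funext fun t => (sharp_halfSucc α β t).trans (by simp only [Pi.add_apply, Function.const]; ring)

/-- The increment `α ((i + 1) / 2 ^ n) - α (i / 2 ^ n)`. -/
def diff (n : ℕ) (α : DyadicFun) (i : Fin (2 ^ n)) : ℚ :=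
  α (node n (i + 1) i.2) - α (node n i i.2.le)

end DyadicFun

section scriptL

open DyadicI DyadicFun

variable {F : Type u} [Field F]

theorem scriptL_eq_sum_mu (n : ℕ) (α : DyadicFun) :
    scriptL F n α = ∑ i : Fin (2 ^ n), Gamma.mu F i ⊗ₜ[ℤ] α.diff n i := by
  refine Finset.sum_congr rfl fun i _ => ?_
  change ((-1) ^ (i : ℕ) * Gamma.mu F i) ⊗ₜ[ℤ] (α.diff n i * (-1) ^ (i : ℕ)) = _
  rcases Nat.even_or_odd (i : ℕ) with h | h
  · rw [h.neg_one_pow, h.neg_one_pow, one_mul, mul_one]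
  · rw [h.neg_one_pow, h.neg_one_pow, neg_one_mul, mul_neg_one, TensorProduct.neg_tmul,
      TensorProduct.tmul_neg, neg_neg]

theorem scriptL_add (n : ℕ) (α β : DyadicFun) :
    scriptL F n (α + β) = scriptL F n α + scriptL F n β := by
  simp only [scriptL_eq_sum_mu, ← Finset.sum_add_distrib, ← TensorProduct.tmul_add,
    DyadicFun.diff, Pi.add_apply, add_sub_add_comm]

theorem scriptL_const (n : ℕ) (c : ℚ) : scriptL F n (Function.const _ c) = 0 := by
  simp [scriptL_eq_sum_mu, DyadicFun.diff]

theorem scriptL_zero (α : DyadicFun) :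
    scriptL F 0 α = (1 : Gamma F) ⊗ₜ[ℤ] (α one - α zero) := by
  rw [scriptL_eq_sum_mu, ← Gamma.mu_zero, ← node_zero 0, ← node_two_pow 0]
  exact Fin.sum_univ_one _

theorem scriptL_succ [CharP F 2] (n : ℕ) (α : DyadicFun) :
    scriptL F (n + 1) α = scriptL F n (T0 α) +
      (Gamma.mu F (2 ^ n) ⊗ₜ[ℤ] (1 : ℚ)) * scriptL F n (T1 α) := by
  have hq : 2 ^ n + 2 ^ n = 2 ^ (n + 1) := by ring
  rw [scriptL_eq_sum_mu, scriptL_eq_sum_mu, scriptL_eq_sum_mu, ← (finCongr hq).sum_comp,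
    Fin.sum_univ_add, Finset.mul_sum]
  congr 1 <;> refine Finset.sum_congr rfl fun i _ => ?_ <;> have hi := i.2
  · simp only [DyadicFun.diff, T0, finCongr_apply, Fin.val_cast, Fin.val_castAdd]
    rw [half_node _ _ _ (by omega), half_node _ _ _ (by omega)]
  · simp only [DyadicFun.diff, T1, finCongr_apply, Fin.val_cast, Fin.val_natAdd, add_assoc]
    rw [halfSucc_node _ _ _ (by omega), halfSucc_node _ _ _ (by omega),
      Algebra.TensorProduct.tmul_mul_tmul, one_mul, Gamma.mu_two_pow_mul_mu hi]

theorem scriptL_sharp [CharP F 2] (n : ℕ) (α β : DyadicFun) :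
    scriptL F n (sharp α β) = scriptL F n α * scriptL F n β := by
  induction n generalizing α β with
  | zero =>
    rw [scriptL_zero, scriptL_zero, scriptL_zero, Algebra.TensorProduct.tmul_mul_tmul, one_mul,
      sharp_one, sharp_zero, sub_zero]
  | succ n ih =>
    have hsq : (Gamma.mu F (2 ^ n) ⊗ₜ[ℤ] (1 : ℚ)) * (Gamma.mu F (2 ^ n) ⊗ₜ[ℤ] (1 : ℚ)) = 1 := by
      rw [Algebra.TensorProduct.tmul_mul_tmul, Gamma.mu_two_pow_mul_self, one_mul,
        Algebra.TensorProduct.one_def]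
    rw [scriptL_succ, scriptL_succ n α, scriptL_succ n β, T0_sharp, T1_sharp]
    simp only [scriptL_add, scriptL_const, ih, add_zero]
    linear_combination (-(scriptL F n (T1 α) * scriptL F n (T1 β))) * hsq

/-- The `ℚ`-linear extension of the rank jump to `Γ_ℚ`, as an additive map. -/
def GammaQ.jump (F : Type u) [Field F] (k : ℕ) : GammaQ F →ₗ[ℤ] ℚ :=
  TensorProduct.lift ((LinearMap.lsmul ℤ ℚ).comp (Gamma.jump F k).toIntLinearMap)

theorem GammaQ.jump_tmul (k : ℕ) (x : Gamma F) (c : ℚ) :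
    GammaQ.jump F k (x ⊗ₜ c) = Gamma.jump F k x • c := rfl

theorem GammaQ.jump_scriptL (n : ℕ) (α : DyadicFun) (k : Fin (2 ^ n)) :
    GammaQ.jump F k (scriptL F n α) = α.diff n k := by
  simp only [scriptL_eq_sum_mu, map_sum, GammaQ.jump_tmul, Gamma.jump_mu, Fin.val_inj, ite_smul,
    one_smul, zero_smul, Finset.sum_ite_eq, Finset.mem_univ, if_true]

variable (F) in
theorem eq_of_scriptL_eq {α β : DyadicFun} (h0 : α zero = β zero)
    (h : ∀ n, scriptL F n α = scriptL F n β) : α = β := by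
  funext t
  obtain ⟨n, i, hi, rfl⟩ := t.exists_eq_node
  induction i with
  | zero => rw [node_zero, h0]
  | succ i ih =>
    have hdiff : α.diff n ⟨i, hi⟩ = β.diff n ⟨i, hi⟩ := by
      rw [← GammaQ.jump_scriptL (F := F), ← GammaQ.jump_scriptL (F := F), h n]
    rw [DyadicFun.diff, DyadicFun.diff, ih] at hdiff
    exact sub_left_injective hdiff

end scriptL

/-! ### Ranks of matrices -/

section MatrixRank

open Matrix
open scoped Kronecker

variable {K m n : Type*} [Field K] [Fintype m] [Fintype n]

theorem exists_eq_mul_diagonal_mul [DecidableEq m] (M : Matrix m m K) :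
    ∃ (A B : Matrix m m K) (d : m → K), A.det = 1 ∧ B.det = 1 ∧ M = A * diagonal d * B := by
  obtain ⟨P, Q, d, h⟩ := Pivot.exists_list_transvec_mul_diagonal_mul_list_transvec M
  exact ⟨_, _, d, TransvectionStruct.det_toMatrix_prod P, TransvectionStruct.det_toMatrix_prod Q, h⟩

theorem rank_mul_mul_of_det_ne_zero [DecidableEq m] {A B : Matrix m m K} (hA : A.det ≠ 0)
    (hB : B.det ≠ 0) (M : Matrix m m K) : (A * M * B).rank = M.rank := by
  rw [rank_mul_eq_left_of_det_ne_zero _ _ hB, rank_mul_eq_right_of_det_ne_zero _ _ hA]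

theorem rank_map_ringHom {L : Type*} [Field L] (φ : K →+* L) (M : Matrix m m K) :
    (M.map φ).rank = M.rank := by
  classical
  obtain ⟨A, B, d, hA, hB, rfl⟩ := exists_eq_mul_diagonal_mul M
  have hdet : ∀ C : Matrix m m K, C.det = 1 → (C.map φ).det ≠ 0 := fun C hC => by
    rw [← RingHom.mapMatrix_apply, ← RingHom.map_det, hC, map_one]
    exact one_ne_zero
  rw [Matrix.map_mul, Matrix.map_mul, rank_mul_mul_of_det_ne_zero (hdet A hA) (hdet B hB),
    rank_mul_mul_of_det_ne_zero (by simp [hA]) (by simp [hB]), diagonal_map (map_zero φ),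
    rank_diagonal, rank_diagonal]
  simp only [ne_eq, map_eq_zero]

theorem rank_kronecker (M : Matrix m m K) (N : Matrix n n K) :
    (M ⊗ₖ N).rank = M.rank * N.rank := by
  classical
  obtain ⟨A, B, d, hA, hB, rfl⟩ := exists_eq_mul_diagonal_mul M
  obtain ⟨A', B', d', hA', hB', rfl⟩ := exists_eq_mul_diagonal_mul N
  rw [mul_kronecker_mul, mul_kronecker_mul,
    rank_mul_mul_of_det_ne_zero (by simp [det_kronecker, hA, hA'])
      (by simp [det_kronecker, hB, hB']),
    rank_mul_mul_of_det_ne_zero (by simp [hA]) (by simp [hB]),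
    rank_mul_mul_of_det_ne_zero (by simp [hA']) (by simp [hB']),
    diagonal_kronecker_diagonal, rank_diagonal, rank_diagonal, rank_diagonal, ← Fintype.card_prod]
  simp only [ne_eq, mul_eq_zero, not_or]
  exact Fintype.card_congr
    (Equiv.subtypeProdEquivProd (p := fun i => ¬d i = 0) (q := fun i => ¬d' i = 0))

end MatrixRank

/-! ### Truncated power series -/

open MvPowerSeries

/-- The ideal `(u ^ q) = (u_j ^ q : j ∈ σ)` of `R[[u]]`. -/
def truncIdeal (σ R : Type*) [CommRing R] (q : ℕ) : Ideal (MvPowerSeries σ R) :=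
  Ideal.span (Set.range fun j : σ => (X j : MvPowerSeries σ R) ^ q)

/-- The truncated power series algebra `R[[u]] / (u ^ q)`. -/
abbrev TruncPowerSeries (σ R : Type*) [CommRing R] (q : ℕ) : Type _ :=
  MvPowerSeries σ R ⧸ truncIdeal σ R q

namespace TruncPowerSeries

section CommRing

variable {σ R : Type*} [CommRing R] {q : ℕ}

theorem coeff_eq_zero_of_mem_truncIdeal {f : MvPowerSeries σ R} (hf : f ∈ truncIdeal σ R q)
    {a : σ →₀ ℕ} (ha : ∀ j, a j < q) : coeff a f = 0 := by
  classical
  induction hf using Submodule.span_induction generalizing a with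
  | mem x hx =>
    obtain ⟨j, rfl⟩ := hx
    exact X_pow_dvd_iff.1 dvd_rfl a (ha j)
  | zero => exact map_zero _
  | add x y _ _ hx hy => rw [map_add, hx ha, hy ha, add_zero]
  | smul r x _ hx =>
    rw [smul_eq_mul, coeff_mul]
    refine Finset.sum_eq_zero fun b hb => ?_
    have hba : b.2 ≤ a := Finset.HasAntidiagonal.mem_antidiagonal.1 hb ▸ le_add_self
    rw [hx fun j => (hba j).trans_lt (ha j), mul_zero]

theorem mem_truncIdeal_of_coeff_eq_zero (s : Finset σ) {f : MvPowerSeries σ R}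
    (hf : ∀ a : σ →₀ ℕ, (∀ j ∈ s, a j < q) → coeff a f = 0) : f ∈ truncIdeal σ R q := by
  classical
  induction s using Finset.induction_on generalizing f with
  | empty =>
    obtain rfl : f = 0 := MvPowerSeries.ext fun a => hf a (by simp)
    exact zero_mem _
  | insert i s _ ih =>
    let g : MvPowerSeries σ R := fun a => if a i < q then 0 else coeff a f
    have hg : g ∈ truncIdeal σ R q :=
      Ideal.mem_of_dvd _ (X_pow_dvd_iff.2 fun a ha => if_pos ha) (Ideal.subset_span ⟨i, rfl⟩)
    refine (Submodule.sub_mem_iff_left _ hg).1 (ih fun a ha => ?_)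
    change coeff a f - (if a i < q then 0 else coeff a f) = 0
    split_ifs with hi
    · rw [hf a (Finset.forall_mem_insert _ _ _ |>.2 ⟨hi, ha⟩), sub_zero]
    · exact sub_self _

theorem mem_truncIdeal_iff [Finite σ] {f : MvPowerSeries σ R} :
    f ∈ truncIdeal σ R q ↔ ∀ a : σ →₀ ℕ, (∀ j, a j < q) → coeff a f = 0 := by
  have := Fintype.ofFinite σ
  exact ⟨fun hf _ => coeff_eq_zero_of_mem_truncIdeal hf,
    fun hf => mem_truncIdeal_of_coeff_eq_zero Finset.univ fun a ha =>
      hf a fun j => ha j (Finset.mem_univ j)⟩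

/-- An exponent vector with all entries below `q`, as an exponent of a monomial. -/
def exponent [Finite σ] (a : σ → Fin q) : σ →₀ ℕ :=
  Finsupp.equivFunOnFinite.symm fun j => (a j : ℕ)

variable [Finite σ]

theorem exponent_apply (a : σ → Fin q) (j : σ) : exponent a j = a j := rfl

theorem exponent_injective : Function.Injective (exponent : (σ → Fin q) → σ →₀ ℕ) :=
  fun _ _ h => funext fun j => Fin.ext (DFunLike.congr_fun h j)

theorem exists_exponent_eq {a : σ →₀ ℕ} (ha : ∀ j, a j < q) :
    ∃ b : σ → Fin q, exponent b = a :=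
  ⟨fun j => ⟨a j, ha j⟩, Finsupp.ext fun _ => rfl⟩

/-- The coefficients of a power series at the exponents with all entries below `q`. -/
def lowCoeff (σ R : Type*) [CommRing R] [Finite σ] (q : ℕ) :
    MvPowerSeries σ R →ₗ[R] ((σ → Fin q) → R) :=
  LinearMap.pi fun a => coeff (exponent a)

theorem ker_lowCoeff :
    LinearMap.ker (lowCoeff σ R q) = (truncIdeal σ R q).restrictScalars R := by
  ext f
  rw [Submodule.restrictScalars_mem, mem_truncIdeal_iff, LinearMap.mem_ker]
  refine ⟨fun h a ha => ?_, fun h => funext fun a => h _ fun j => (a j).2⟩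
  obtain ⟨b, rfl⟩ := exists_exponent_eq ha
  exact congrFun h b

theorem lowCoeff_surjective : Function.Surjective (lowCoeff σ R q) := by
  classical
  intro c
  refine ⟨fun a => if h : ∀ j, a j < q then c fun j => ⟨a j, h j⟩ else 0, funext fun b => ?_⟩
  exact dif_pos fun j => (b j).2

/-- The coordinates on `R[[u]] / (u ^ q)` given by the monomials. -/
def coeffEquiv (σ R : Type*) [CommRing R] [Finite σ] (q : ℕ) :
    TruncPowerSeries σ R q ≃ₗ[R] ((σ → Fin q) → R) :=
  (Submodule.Quotient.restrictScalarsEquiv R (truncIdeal σ R q)).symm ≪≫ₗ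
    Submodule.quotEquivOfEq _ _ ker_lowCoeff.symm ≪≫ₗ
    (lowCoeff σ R q).quotKerEquivOfSurjective lowCoeff_surjective

/-- The basis of `R[[u]] / (u ^ q)` consisting of the monomials with exponents below `q`. -/
def monomialBasis (σ R : Type*) [CommRing R] [Finite σ] (q : ℕ) :
    Module.Basis (σ → Fin q) R (TruncPowerSeries σ R q) :=
  .ofEquivFun (coeffEquiv σ R q)

theorem monomialBasis_repr_mk (f : MvPowerSeries σ R) (a : σ → Fin q) :
    (monomialBasis σ R q).repr (Ideal.Quotient.mk _ f) a = coeff (exponent a) f := rfl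

theorem monomialBasis_apply (a : σ → Fin q) :
    monomialBasis σ R q a = Ideal.Quotient.mk _ (monomial (exponent a) 1) := by
  classical
  refine (monomialBasis σ R q).ext_elem fun b => ?_
  rw [Module.Basis.repr_self, monomialBasis_repr_mk, coeff_monomial, Finsupp.single_apply]
  simp only [exponent_injective.eq_iff, eq_comm]

instance : Module.Finite R (TruncPowerSeries σ R q) :=
  .of_basis (monomialBasis σ R q)

end CommRing

section Colength

variable {σ F : Type*} [Field F]

theorem finrank_eq [Fintype σ] (q : ℕ) :
    Module.finrank F (TruncPowerSeries σ F q) = q ^ Fintype.card σ := by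
  classical
  rw [Module.finrank_eq_card_basis (monomialBasis σ F q), Fintype.card_fun, Fintype.card_fin]

/-- Multiplication by `f` on `F[[u]] / (u ^ q)`. -/
def mulEnd (q : ℕ) (f : MvPowerSeries σ F) : Module.End F (TruncPowerSeries σ F q) :=
  LinearMap.mulLeft F (Ideal.Quotient.mk (truncIdeal σ F q) f)

theorem mulEnd_mk (q : ℕ) (f g : MvPowerSeries σ F) :
    mulEnd q f (Ideal.Quotient.mk _ g) = Ideal.Quotient.mk _ (f * g) := rfl

theorem mulEnd_pow (q k : ℕ) (f : MvPowerSeries σ F) : mulEnd q f ^ k = mulEnd q (f ^ k) := by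
  rw [mulEnd, mulEnd, LinearMap.pow_mulLeft, map_pow]

theorem mulEnd_eq_zero {q : ℕ} {f : MvPowerSeries σ F} (hf : f ∈ truncIdeal σ F q) :
    mulEnd q f = 0 := by
  rw [mulEnd, Ideal.Quotient.eq_zero_iff_mem.2 hf, LinearMap.mulLeft_zero_eq_zero]

theorem frobColength_eq_finrank_quotient_range (f : MvPowerSeries σ F) (q i : ℕ) :
    frobColength f q i =
      Module.finrank F (TruncPowerSeries σ F q ⧸ LinearMap.range (mulEnd q (f ^ i))) := by
  have hrange : (Ideal.span {Ideal.Quotient.mkₐ F (truncIdeal σ F q) (f ^ i)}).restrictScalars F =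
      LinearMap.range (mulEnd q (f ^ i)) := by
    ext x
    rw [Submodule.restrictScalars_mem, Ideal.mem_span_singleton]
    exact exists_congr fun y => eq_comm
  rw [frobColength, Ideal.span_union, ← truncIdeal,
    ← (DoubleQuot.quotQuotEquivQuotSupₐ F (truncIdeal σ F q)
      (Ideal.span {f ^ i})).toLinearEquiv.finrank_eq, Ideal.map_span, Set.image_singleton, ← hrange]
  exact (Submodule.Quotient.restrictScalarsEquiv F _).symm.finrank_eq

variable [Fintype σ]

theorem frobColength_add_finrank_range (f : MvPowerSeries σ F) (q i : ℕ) :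
    frobColength f q i + Module.finrank F (LinearMap.range (mulEnd q (f ^ i))) =
      q ^ Fintype.card σ := by
  rw [frobColength_eq_finrank_quotient_range, Submodule.finrank_quotient_add_finrank, finrank_eq]

variable [DecidableEq σ]

/-- The matrix of the multiplication by `f` on `F[[u]] / (u ^ q)` in the basis of monomials. -/
def mulMatrix (q : ℕ) (f : MvPowerSeries σ F) : Matrix (σ → Fin q) (σ → Fin q) F :=
  LinearMap.toMatrix (monomialBasis σ F q) (monomialBasis σ F q) (mulEnd q f)

theorem mulMatrix_apply (q : ℕ) (f : MvPowerSeries σ F) (a b : σ → Fin q) :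
    mulMatrix q f a b =
      if exponent b ≤ exponent a then coeff (exponent a - exponent b) f else 0 := by
  rw [mulMatrix, LinearMap.toMatrix_apply, monomialBasis_apply, mulEnd_mk, monomialBasis_repr_mk,
    coeff_mul_monomial, mul_one]

theorem rank_mulMatrix (q : ℕ) (f : MvPowerSeries σ F) :
    (mulMatrix q f).rank = Module.finrank F (LinearMap.range (mulEnd q f)) := by
  rw [Matrix.rank_eq_finrank_range_toLin _ (monomialBasis σ F q) (monomialBasis σ F q), mulMatrix,
    Matrix.toLin_toMatrix]

end Colength

section CharP

variable {σ F : Type*} [Field F] {p : ℕ}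

/-- Splitting off the lowest base `p` digit of each coordinate. -/
def digitEquiv (σ : Type*) (q p : ℕ) : (σ → Fin q) × (σ → Fin p) ≃ (σ → Fin (q * p)) :=
  (Equiv.arrowProdEquivProdArrow σ (fun _ => Fin q) (fun _ => Fin p)).symm.trans
    (Equiv.arrowCongr (Equiv.refl σ) finProdFinEquiv)

theorem exponent_digitEquiv [Finite σ] {q : ℕ} (x : (σ → Fin q) × (σ → Fin p)) (j : σ) :
    exponent (digitEquiv σ q p x) j = x.2 j + p * x.1 j := rfl

theorem exponent_digitEquiv_sub [Finite σ] {q : ℕ} (a b : σ → Fin q) (c : σ → Fin p) :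
    exponent (digitEquiv σ q p (a, c)) - exponent (digitEquiv σ q p (b, c)) =
      p • (exponent a - exponent b) := by
  refine Finsupp.ext fun j => ?_
  rw [Finsupp.tsub_apply, Finsupp.smul_apply, Finsupp.tsub_apply, exponent_digitEquiv,
    exponent_digitEquiv, exponent_apply, exponent_apply, smul_eq_mul, Nat.mul_sub,
    Nat.add_sub_add_left]

theorem not_dvd_exponent_digitEquiv_sub [Finite σ] {q : ℕ} {x y : (σ → Fin q) × (σ → Fin p)}
    (hle : exponent (digitEquiv σ q p y) ≤ exponent (digitEquiv σ q p x)) {j : σ}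
    (hj : x.2 j ≠ y.2 j) :
    ¬ p ∣ (exponent (digitEquiv σ q p x) - exponent (digitEquiv σ q p y)) j := by
  have hlej := hle j
  rw [Finsupp.tsub_apply]
  rw [exponent_digitEquiv, exponent_digitEquiv] at hlej ⊢
  rw [← Nat.modEq_iff_dvd' hlej]
  intro hmod
  refine hj (Fin.ext ?_)
  simpa [Nat.ModEq, Nat.mod_eq_of_lt (x.2 j).2, Nat.mod_eq_of_lt (y.2 j).2] using hmod.symm

variable [Fact p.Prime]

theorem exponent_digitEquiv_le_iff [Finite σ] {q : ℕ} (a b : σ → Fin q) (c : σ → Fin p) :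
    exponent (digitEquiv σ q p (b, c)) ≤ exponent (digitEquiv σ q p (a, c)) ↔
      exponent b ≤ exponent a := by
  refine forall_congr' fun j => ?_
  rw [exponent_digitEquiv, exponent_digitEquiv, exponent_apply, exponent_apply,
    Nat.add_le_add_iff_left, Nat.mul_le_mul_left_iff (Fact.out : p.Prime).pos]

variable [CharP F p]

theorem coeff_smul_pow_char (f : MvPowerSeries σ F) (a : σ →₀ ℕ) :
    coeff (p • a) (f ^ p) = frobenius F p (coeff a f) := by
  rw [← map_frobenius_expand p (NeZero.ne p), coeff_map, coeff_expand_smul]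

theorem coeff_pow_char_of_not_dvd (f : MvPowerSeries σ F) {a : σ →₀ ℕ} {j : σ}
    (h : ¬ p ∣ a j) : coeff a (f ^ p) = 0 := by
  rw [← map_frobenius_expand p (NeZero.ne p), coeff_map,
    coeff_expand_of_not_dvd p (NeZero.ne p) f h, map_zero]

variable [Fintype σ]

open scoped Kronecker in
theorem mulMatrix_pow_char [DecidableEq σ] (q : ℕ) (f : MvPowerSeries σ F) :
    (mulMatrix (q * p) (f ^ p)).submatrix (digitEquiv σ q p) (digitEquiv σ q p) =
      (mulMatrix q f).map (frobenius F p) ⊗ₖ 1 := by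
  ext ⟨a, c⟩ ⟨b, d⟩
  rw [Matrix.submatrix_apply, Matrix.kroneckerMap_apply, Matrix.map_apply, Matrix.one_apply,
    mulMatrix_apply, mulMatrix_apply]
  rcases eq_or_ne c d with rfl | hcd
  · rw [if_pos rfl, mul_one, exponent_digitEquiv_sub, coeff_smul_pow_char]
    simp only [exponent_digitEquiv_le_iff, apply_ite (frobenius F p), map_zero]
  · rw [if_neg hcd, mul_zero, ite_eq_right_iff]
    intro hle
    obtain ⟨j, hj⟩ := Function.ne_iff.1 hcd
    exact coeff_pow_char_of_not_dvd f (not_dvd_exponent_digitEquiv_sub hle hj)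

theorem frobColength_mul_char (f : MvPowerSeries σ F) (q i : ℕ) :
    frobColength f (q * p) (i * p) = frobColength f q i * p ^ Fintype.card σ := by
  classical
  have hrank : (mulMatrix (q * p) (f ^ (i * p))).rank =
      (mulMatrix q (f ^ i)).rank * p ^ Fintype.card σ := by
    rw [pow_mul, ← Matrix.rank_submatrix _ (digitEquiv σ q p) (digitEquiv σ q p),
      mulMatrix_pow_char, rank_kronecker, rank_map_ringHom, Matrix.rank_one, Fintype.card_fun,
      Fintype.card_fin]
  have h := frobColength_add_finrank_range f (q * p) (i * p)
  rw [← rank_mulMatrix, hrank, mul_pow, ← frobColength_add_finrank_range f q i, ← rank_mulMatrix,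
    add_mul] at h
  exact Nat.add_right_cancel h

theorem frobColength_mul_char_pow (f : MvPowerSeries σ F) (q i m : ℕ) :
    frobColength f (q * p ^ m) (i * p ^ m) =
      frobColength f q i * (p ^ m) ^ Fintype.card σ := by
  induction m with
  | zero => simp only [pow_zero, mul_one, one_pow]
  | succ m ih =>
    rw [pow_succ, ← mul_assoc, ← mul_assoc, frobColength_mul_char, ih, mul_pow, mul_assoc]

end CharP

end TruncPowerSeries

theorem phi_node {σ F : Type*} [Field F] [CharP F 2] [Fintype σ] (f : MvPowerSeries σ F)
    (n i : ℕ) (hi : i ≤ 2 ^ n) :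
    phi f (DyadicI.node n i hi) =
      (frobColength f (2 ^ n) i : ℚ) / ((2 ^ n : ℕ) : ℚ) ^ Fintype.card σ := by
  obtain ⟨m, hnum, hden⟩ := DyadicI.exists_eq_num_mul_eq_den_mul n i hi
  generalize DyadicI.node n i hi = t at hnum hden ⊢
  rw [hden, hnum, TruncPowerSeries.frobColength_mul_char_pow, phi]
  push_cast
  rw [mul_pow, mul_div_mul_right _ _ (by positivity)]

/-! ### Truncated power series as modules over `F[T]` -/

theorem mem_maximalIdeal_iff_constantCoeff_eq_zero {σ F : Type*} [Field F]
    {f : MvPowerSeries σ F} :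
    f ∈ IsLocalRing.maximalIdeal (MvPowerSeries σ F) ↔ constantCoeff f = 0 := by
  rw [IsLocalRing.mem_maximalIdeal, mem_nonunits_iff, isUnit_iff_constantCoeff, isUnit_iff_ne_zero,
    not_not]

theorem rename_add_rename_mem_maximalIdeal {σ τ F : Type*} [Finite σ] [Finite τ] [Field F]
    {f : MvPowerSeries σ F} {g : MvPowerSeries τ F}
    (hf : f ∈ IsLocalRing.maximalIdeal (MvPowerSeries σ F))
    (hg : g ∈ IsLocalRing.maximalIdeal (MvPowerSeries τ F)) :
    rename Sum.inl f + rename Sum.inr g ∈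
      IsLocalRing.maximalIdeal (MvPowerSeries (σ ⊕ τ) F) := by
  rw [mem_maximalIdeal_iff_constantCoeff_eq_zero] at hf hg ⊢
  rw [map_add, constantCoeff_rename, constantCoeff_rename, hf, hg, add_zero]

theorem phi_zero {σ F : Type*} [Field F] [CharP F 2] [Fintype σ] (f : MvPowerSeries σ F) :
    phi f DyadicI.zero = 0 := by
  have h := TruncPowerSeries.frobColength_add_finrank_range f (2 ^ 0) 0
  rw [pow_zero f, TruncPowerSeries.mulEnd, map_one, LinearMap.mulLeft_one, LinearMap.range_id,
    finrank_top, TruncPowerSeries.finrank_eq, Nat.add_eq_right] at h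
  rw [← DyadicI.node_zero 0, phi_node, h, Nat.cast_zero, zero_div]

namespace TruncPowerSeries

section Nilpotent

variable {σ F : Type*} [Field F] [Finite σ] {f : MvPowerSeries σ F}

theorem mem_truncIdeal_one (hf : f ∈ IsLocalRing.maximalIdeal (MvPowerSeries σ F)) :
    f ∈ truncIdeal σ F 1 := by
  refine mem_truncIdeal_iff.2 fun a ha => ?_
  obtain rfl : a = 0 := Finsupp.ext fun j => Nat.lt_one_iff.1 (ha j)
  exact mem_maximalIdeal_iff_constantCoeff_eq_zero.1 hf

theorem isNilpotent_mulEnd (q : ℕ) (hf : f ∈ IsLocalRing.maximalIdeal (MvPowerSeries σ F)) :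
    IsNilpotent (mulEnd q f) := by
  have hle : truncIdeal σ F 1 ≤ (truncIdeal σ F q).radical := by
    refine Ideal.span_le.2 ?_
    rintro _ ⟨j, rfl⟩
    beta_reduce
    rw [SetLike.mem_coe, pow_one]
    exact ⟨q, Ideal.subset_span ⟨j, rfl⟩⟩
  obtain ⟨N, hN⟩ := hle (mem_truncIdeal_one hf)
  exact ⟨N, (mulEnd_pow q N f).trans (mulEnd_eq_zero hN)⟩

theorem mulEnd_pow_char_pow {p : ℕ} [Fact p.Prime] [CharP F p]
    (hf : f ∈ IsLocalRing.maximalIdeal (MvPowerSeries σ F)) (n : ℕ) :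
    mulEnd (p ^ n) f ^ p ^ n = 0 := by
  have : CharP (MvPowerSeries σ F) p :=
    charP_of_injective_algebraMap (algebraMap F (MvPowerSeries σ F)).injective p
  have hle : truncIdeal σ F 1 ≤ (truncIdeal σ F (p ^ n)).comap
      (iterateFrobenius (MvPowerSeries σ F) p n) := by
    refine Ideal.span_le.2 ?_
    rintro _ ⟨j, rfl⟩
    beta_reduce
    rw [SetLike.mem_coe, pow_one]
    exact Ideal.subset_span ⟨j, rfl⟩
  exact (mulEnd_pow _ _ f).trans (mulEnd_eq_zero (hle (mem_truncIdeal_one hf)))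

end Nilpotent

section Rename

variable {σ τ F : Type*} [Field F]

/-- Renaming the variables of a truncated power series. -/
def renameHom (q : ℕ) (e : σ → τ) [Filter.TendstoCofinite e] :
    TruncPowerSeries σ F q →ₐ[F] TruncPowerSeries τ F q :=
  Ideal.quotientMapₐ (truncIdeal τ F q) (rename e) (Ideal.span_le.2 (by
    rintro _ ⟨j, rfl⟩
    refine Ideal.mem_comap.2 ?_
    rw [map_pow, rename_X]
    exact Ideal.subset_span ⟨e j, rfl⟩))

/-- The multiplication `F[[u]] / (u ^ q) ⊗ F[[v]] / (v ^ q) → F[[u, v]] / (u ^ q, v ^ q)`. -/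
def prodHom (σ τ F : Type*) [Field F] [Finite σ] [Finite τ] (q : ℕ) :
    TruncPowerSeries σ F q ⊗[F] TruncPowerSeries τ F q →ₐ[F] TruncPowerSeries (σ ⊕ τ) F q :=
  Algebra.TensorProduct.productMap (renameHom q Sum.inl) (renameHom q Sum.inr)

variable [Finite σ] [Finite τ]

theorem prodHom_mk_tmul_mk (q : ℕ) (f : MvPowerSeries σ F) (g : MvPowerSeries τ F) :
    prodHom σ τ F q (Ideal.Quotient.mk _ f ⊗ₜ Ideal.Quotient.mk _ g) =
      Ideal.Quotient.mk _ (rename Sum.inl f * rename Sum.inr g) := rfl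

theorem exponent_sum {q : ℕ} (a : σ ⊕ τ → Fin q) :
    exponent a = (exponent (a ∘ Sum.inl)).mapDomain Sum.inl +
      (exponent (a ∘ Sum.inr)).mapDomain Sum.inr := by
  refine Finsupp.ext (Sum.rec (fun j => ?_) fun j => ?_)
  · rw [Finsupp.add_apply, Finsupp.mapDomain_apply Sum.inl_injective,
      Finsupp.mapDomain_of_notMem_range _ _ (by simp), add_zero]
    rfl
  · rw [Finsupp.add_apply, Finsupp.mapDomain_apply Sum.inr_injective,
      Finsupp.mapDomain_of_notMem_range _ _ (by simp), zero_add]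
    rfl

theorem prodHom_monomialBasis {q : ℕ} (a : σ ⊕ τ → Fin q) :
    prodHom σ τ F q (monomialBasis σ F q (a ∘ Sum.inl) ⊗ₜ monomialBasis τ F q (a ∘ Sum.inr)) =
      monomialBasis (σ ⊕ τ) F q a := by
  rw [monomialBasis_apply, monomialBasis_apply, monomialBasis_apply, prodHom_mk_tmul_mk,
    rename_monomial, rename_monomial, monomial_mul_monomial, one_mul, exponent_sum]

theorem prodHom_surjective (q : ℕ) : Function.Surjective (prodHom σ τ F q) := by
  change Function.Surjective (prodHom σ τ F q).toLinearMap
  rw [← LinearMap.range_eq_top, eq_top_iff, ← (monomialBasis (σ ⊕ τ) F q).span_eq,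
    Submodule.span_le]
  rintro _ ⟨a, rfl⟩
  exact ⟨monomialBasis σ F q (a ∘ Sum.inl) ⊗ₜ monomialBasis τ F q (a ∘ Sum.inr),
    prodHom_monomialBasis a⟩

theorem prodHom_bijective (q : ℕ) : Function.Bijective (prodHom σ τ F q) := by
  have := Fintype.ofFinite σ
  have := Fintype.ofFinite τ
  have h : Module.finrank F (TruncPowerSeries σ F q ⊗[F] TruncPowerSeries τ F q) =
      Module.finrank F (TruncPowerSeries (σ ⊕ τ) F q) := by
    rw [Module.finrank_tensorProduct, finrank_eq, finrank_eq, finrank_eq, Fintype.card_sum,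
      pow_add]
  exact ⟨(LinearMap.injective_iff_surjective_of_finrank_eq_finrank
    (f := (prodHom σ τ F q).toLinearMap) h).2 (prodHom_surjective q), prodHom_surjective q⟩

theorem prodHom_mulEnd (q : ℕ) (f : MvPowerSeries σ F) (g : MvPowerSeries τ F)
    (x : TruncPowerSeries σ F q) (y : TruncPowerSeries τ F q) :
    prodHom σ τ F q (mulEnd q f x ⊗ₜ y + x ⊗ₜ mulEnd q g y) =
      mulEnd q (rename Sum.inl f + rename Sum.inr g) (prodHom σ τ F q (x ⊗ₜ y)) := by
  obtain ⟨a, rfl⟩ := Ideal.Quotient.mk_surjective x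
  obtain ⟨b, rfl⟩ := Ideal.Quotient.mk_surjective y
  rw [map_add, mulEnd_mk, mulEnd_mk, prodHom_mk_tmul_mk, prodHom_mk_tmul_mk, prodHom_mk_tmul_mk,
    mulEnd_mk, ← map_add, map_mul, map_mul]
  ring_nf

end Rename

section NilMod

variable {σ τ : Type} {F : Type u} [Field F] {f : MvPowerSeries σ F} {g : MvPowerSeries τ F}

/-- The `F[T]`-module `F[[u]] / (u ^ q)`, on which `T` acts as the multiplication by `f`. -/
def nilMod [Finite σ] (q : ℕ) (hf : f ∈ IsLocalRing.maximalIdeal (MvPowerSeries σ F)) :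
    NilMod F where
  carrier := TruncPowerSeries σ F q
  T := mulEnd q f
  nilpotent := isNilpotent_mulEnd q hf

theorem nilMod_tensor_iso [Finite σ] [Finite τ] (q : ℕ)
    (hf : f ∈ IsLocalRing.maximalIdeal (MvPowerSeries σ F))
    (hg : g ∈ IsLocalRing.maximalIdeal (MvPowerSeries τ F)) :
    ((nilMod q hf).tensor (nilMod q hg)).Iso
      (nilMod q (rename_add_rename_mem_maximalIdeal hf hg)) :=
  ⟨LinearEquiv.ofBijective (prodHom σ τ F q).toLinearMap (prodHom_bijective q),
    TensorProduct.ext' fun x y => prodHom_mulEnd q f g x y⟩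

theorem jump_nilMod [Finite σ] (q : ℕ)
    (hf : f ∈ IsLocalRing.maximalIdeal (MvPowerSeries σ F)) (i : ℕ) :
    (nilMod q hf).jump i = frobColength f q (i + 1) - frobColength f q i := by
  have := Fintype.ofFinite σ
  have hrk : ∀ k, frobColength f q k + (nilMod q hf).rk k = q ^ Fintype.card σ := fun k => by
    rw [← frobColength_add_finrank_range f q k, ← mulEnd_pow]
    rfl
  have h := (hrk i).trans (hrk (i + 1)).symm
  rw [NilMod.jump]
  omega

variable [Fintype σ] [Fintype τ] [CharP F 2]

theorem scriptL_phi (n : ℕ) (hf : f ∈ IsLocalRing.maximalIdeal (MvPowerSeries σ F)) :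
    scriptL F n (phi f) =
      Gamma.cls (nilMod (2 ^ n) hf) ⊗ₜ[ℤ] (((2 ^ n : ℕ) : ℚ) ^ Fintype.card σ)⁻¹ := by
  have hT : (nilMod (2 ^ n) hf).T ^ 2 ^ n = 0 := mulEnd_pow_char_pow hf n
  rw [scriptL_eq_sum_mu, Gamma.cls_eq_sum_jump hT, TensorProduct.sum_tmul, Finset.sum_range]
  refine Finset.sum_congr rfl fun i _ => ?_
  rw [TensorProduct.smul_tmul, jump_nilMod, DyadicFun.diff, phi_node, phi_node, ← sub_div,
    zsmul_eq_mul, div_eq_mul_inv]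
  push_cast
  rfl

theorem scriptL_phi_rename_add_rename (n : ℕ)
    (hf : f ∈ IsLocalRing.maximalIdeal (MvPowerSeries σ F))
    (hg : g ∈ IsLocalRing.maximalIdeal (MvPowerSeries τ F)) :
    scriptL F n (phi (rename Sum.inl f + rename Sum.inr g)) =
      scriptL F n (phi f) * scriptL F n (phi g) := by
  rw [scriptL_phi n hf, scriptL_phi n hg,
    scriptL_phi n (rename_add_rename_mem_maximalIdeal hf hg),
    Algebra.TensorProduct.tmul_mul_tmul, ← Gamma.cls_tensor,
    Gamma.cls_eq (nilMod_tensor_iso (2 ^ n) hf hg), Fintype.card_sum, pow_add, mul_inv]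

end NilMod

end TruncPowerSeries

theorem theorem1p9_general {F : Type*} [Field F] [CharP F 2] {σ τ : Type} [Fintype σ] [Fintype τ]
    (f : MvPowerSeries σ F) (g : MvPowerSeries τ F)
    (hf : f ∈ IsLocalRing.maximalIdeal (MvPowerSeries σ F))
    (hg : g ∈ IsLocalRing.maximalIdeal (MvPowerSeries τ F)) :
    (∀ n : ℕ, scriptL F n (phi (rename Sum.inl f + rename Sum.inr g)) =
        scriptL F n (phi f) * scriptL F n (phi g)) ∧
      phi (rename Sum.inl f + rename Sum.inr g) = DyadicFun.sharp (phi f) (phi g) := by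
  have hL := fun n => TruncPowerSeries.scriptL_phi_rename_add_rename n hf hg
  refine ⟨hL, eq_of_scriptL_eq F ?_ fun n => ?_⟩
  · rw [phi_zero, DyadicFun.sharp_zero]
  · rw [hL, scriptL_sharp]

end

/-- Here `h = f(u) + g(v)` in `F[[u, v]]`, the variables `u` and `v` being indexed by the two
summands of `Fin r ⊕ Fin s`. -/
theorem theorem1p9 {F : Type*} [Field F] [CharP F 2] {r s : ℕ}
    (f : MvPowerSeries (Fin r) F) (g : MvPowerSeries (Fin s) F)
    (hf0 : f ≠ 0) (hf : f ∈ IsLocalRing.maximalIdeal (MvPowerSeries (Fin r) F))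
    (hg0 : g ≠ 0) (hg : g ∈ IsLocalRing.maximalIdeal (MvPowerSeries (Fin s) F))
    (h : MvPowerSeries (Fin r ⊕ Fin s) F)
    (hh : h = MvPowerSeries.rename Sum.inl f + MvPowerSeries.rename Sum.inr g) :
    (∀ n : ℕ, scriptL F n (phi h) = scriptL F n (phi f) * scriptL F n (phi g)) ∧
      phi h = DyadicFun.sharp (phi f) (phi g) := by
  subst hh
  exact theorem1p9_general f g hf hg
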